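/- **Setting.** $G$ single-antenna transmitters serve $G$ groups of single-antenna users through an amplify-and-forward relay with $L$ antennas; group $k$ has $m_k$ users and $M=\sum_k m_k$. Given are transmit powers $P_j\ge0$, channels $f_j\in\mathbb C^L$ (transmitter $j$ to relay) and $g_{k,i}\in\mathbb C^L$ (relay to user $i$ of group $k$), noise variances $\sigma_\ell^2>0$ at the relay antennas and $\sigma_{k,i}^2>0$ at the users, a total power threshold $\bar P_0>0$ and per-antenna thresholds $\bar P_1,\dots,\bar P_L>0$. Put $\Sigma_L=\mathrm{Diag}(\sigma_1^2,\dots,\sigma_L^2)$ and, with $f^*$ the entrywise conjugate, $K=\sum_{j}P_jf_j^*(f_j^*)^H+\Sigma_L$, $$A_{k,i}=\frac{P_k}{\sigma_{k,i}^2}(f_k^*\otimes g_{k,i})(f_k^*\otimes g_{k,i})^H,\qquad C_{k,i}=\sum_{j\ne k}\frac{P_j}{\sigma_{k,i}^2}(f_j^*\otimes g_{k,i})(f_j^*\otimes g_{k,i})^H+\frac{1}{\sigma_{k,i}^2}\Sigma_L\otimes g_{k,i}g_{k,i}^H,$$ $$D_0=K\otimes I_L,\qquad D_\ell=K\otimes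 e_\ell e_\ell^H\ (1\le\ell\le L).$$ With $A\bullet B=\mathrm{Tr}(A^HB)$ let $\gamma(W)=\min_{k,i}\frac{A_{k,i}\bullet W}{C_{k,i}\bullet W+1}$. Problem (SDR) is to maximize $\gamma(W)$ over the Hermitian positive semidefinite matrices $W$ of order $L^2$ with $D_\ell\bullet W\le\bar P_\ell$ for $\ell=0,1,\dots,L$. **Randomization procedure.** Input: an optimal solution $W^\star$ of (SDR) and $N\ge1$. If $\mathrm{rank}(W^\star)\le1$, output some $\hat w$ with $W^\star=\hat w\hat w^H$. Otherwise draw independent $\xi^1,\dots,\xi^N\sim\mathcal{CN}(0,W^\star)$ (circularly symmetric complex Gaussian), put $\hat w^n=\xi^n\min_{0\le\ell\le L}\sqrt{\bar P_\ell/(D_\ell\bullet\xi^n(\xi^n)^H)}$ (a quotient with denominator $0$ counts as $+\infty$; $\hat w^n=0$ if $\xi^n=0$), and output $\hat w=\hat w^{n}$ for some $n$ that maximizes $\gamma(\hat w^n(\hat w^n)^H)$. Let $r_{\sf SDR}=\log(1+\gamma(W^\star))$ and $r_{\sf BF}=\log(1+\gamma(\hat w\hat w^H))$, with natural logarithms (nats/s/Hz).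 **Theorem.** Let $M\ge1$ and $L\ge2$. (a) If $M+L\le3$, an optimal solution $W^\star$ of (SDR) with $\mathrm{rank}(W^\star)\le1$ exists and can be found efficiently: it can be computed from the real and imaginary parts of the data, exactly, by a program over the reals (rational constants, $+,-,\times,/$, square roots, sign tests) with a number of instructions that is polynomial in $G+M+L$. For every such $W^\star$, and every $N\ge1$, the procedure has an output on input $W^\star$, and every output $\hat w$ satisfies $r_{\sf BF}=r_{\sf SDR}$. (b) If $M+L>3$, then for every optimal solution $W^\star$ of (SDR) and every $N\ge1$, the output $\hat w$ of the procedure satisfies $$r_{\sf SDR}-r_{\sf BF}\le\log M+\log\bigl(\log(3(L+1))+\tfrac16\bigr)+\log48$$ with probability at least $1-(5/6)^N$. -/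

import Mathlib

open MeasureTheory ProbabilityTheory
open scoped Kronecker ComplexConjugate ComplexOrder

noncomputable section

/-- Data of a one-way multigroup multicast MIMO relay network: `G` transmitters (one per group),
`m k` users in group `k`, and a relay with `L` antennas. -/
structure RelayNetwork (G : ℕ) (m : Fin G → ℕ) (L : ℕ) where
  /-- transmit powers -/
  P : Fin G → ℝ
  /-- channels from the transmitters to the relay antennas -/
  f : Fin G → Fin L → ℂ
  /-- channels from the relay antennas to the users -/
  g : (Σ k, Fin (m k)) → Fin L → ℂ
  /-- standard deviations of the noise at the relay antennas -/
  σR : Fin L → ℝ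
  /-- standard deviations of the noise at the users -/
  σU : (Σ k, Fin (m k)) → ℝ
  /-- power thresholds: `none` is the total power, `some ℓ` the power of antenna `ℓ` -/
  Pbar : Option (Fin L) → ℝ
  P_nonneg : ∀ j, 0 ≤ P j
  σR_pos : ∀ l, 0 < σR l
  σU_pos : ∀ u, 0 < σU u
  Pbar_pos : ∀ l, 0 < Pbar l

/-- Index set of `vec V` for an `L × L` matrix `V`: the pair `(c, r)` is column `c`, row `r`. -/
abbrev VecIdx (L : ℕ) : Type := Fin L × Fin L

/-- The inner product `A • B = Tr (Aᴴ B)`; it is real for Hermitian matrices. -/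
def matInner {n : Type*} [Fintype n] (A B : Matrix n n ℂ) : ℝ :=
  (Matrix.trace (A.conjTranspose * B)).re

/-- The rank-one matrix `w wᴴ`. -/
def outer {n : Type*} (w : n → ℂ) : Matrix n n ℂ :=
  Matrix.vecMulVec w (star w)

namespace RelayNetwork

variable {G : ℕ} {m : Fin G → ℕ} {L : ℕ}

/-- The noise covariance `Σ_L = Diag (σ₁², …, σ_L²)` at the relay. -/
def noiseCov (S : RelayNetwork G m L) : Matrix (Fin L) (Fin L) ℂ :=
  Matrix.diagonal fun l => ((S.σR l ^ 2 : ℝ) : ℂ)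

/-- The vector `f_j^* ⊗ g_u`. -/
def chan (S : RelayNetwork G m L) (j : Fin G) (u : Σ k, Fin (m k)) : VecIdx L → ℂ :=
  fun p => conj (S.f j p.1) * S.g u p.2

/-- The matrix `A_{k,i}` of user `u = (k, i)`. -/
def A (S : RelayNetwork G m L) (u : Σ k, Fin (m k)) : Matrix (VecIdx L) (VecIdx L) ℂ :=
  ((S.P u.1 / S.σU u ^ 2 : ℝ) : ℂ) • outer (S.chan u.1 u)

/-- The matrix `C_{k,i}` of user `u = (k, i)`. -/
def C (S : RelayNetwork G m L) (u : Σ k, Fin (m k)) : Matrix (VecIdx L) (VecIdx L) ℂ :=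
  (∑ j ∈ Finset.univ.filter (fun j => j ≠ u.1),
      ((S.P j / S.σU u ^ 2 : ℝ) : ℂ) • outer (S.chan j u))
    + ((1 / S.σU u ^ 2 : ℝ) : ℂ) • (S.noiseCov ⊗ₖ outer (S.g u))

/-- The matrix `∑ⱼ Pⱼ fⱼ^* (fⱼ^*)ᴴ + Σ_L`. -/
def rxCov (S : RelayNetwork G m L) : Matrix (Fin L) (Fin L) ℂ :=
  (∑ j, ((S.P j : ℝ) : ℂ) • outer (star (S.f j))) + S.noiseCov

/-- The power-constraint matrices: `D none` is `D₀` (total power), `D (some ℓ)` is `D_ℓ`. -/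
def D (S : RelayNetwork G m L) : Option (Fin L) → Matrix (VecIdx L) (VecIdx L) ℂ
  | none => S.rxCov ⊗ₖ (1 : Matrix (Fin L) (Fin L) ℂ)
  | some l => S.rxCov ⊗ₖ Matrix.single l l (1 : ℂ)

/-- The worst-user SINR `γ(W)`, a minimum over all users. -/
def gam (S : RelayNetwork G m L) (W : Matrix (VecIdx L) (VecIdx L) ℂ) : ℝ :=
  ⨅ u : Σ k, Fin (m k), matInner (S.A u) W / (matInner (S.C u) W + 1)

/-- The feasible set of (SDR). -/
def sdrFeasible (S : RelayNetwork G m L) : Set (Matrix (VecIdx L) (VecIdx L) ℂ) :=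
  {W | W.PosSemidef ∧ ∀ l, matInner (S.D l) W ≤ S.Pbar l}

/-- `W` is an optimal solution of (SDR). -/
def IsSDROptimal (S : RelayNetwork G m L) (W : Matrix (VecIdx L) (VecIdx L) ℂ) : Prop :=
  W ∈ S.sdrFeasible ∧ ∀ W' ∈ S.sdrFeasible, S.gam W' ≤ S.gam W

/-- The rate `log (1 + γ(W))` in nats/s/Hz. -/
def rate (S : RelayNetwork G m L) (W : Matrix (VecIdx L) (VecIdx L) ℂ) : ℝ :=
  Real.log (1 + S.gam W)

/-- The vector `ξ · min_ℓ √(P̄_ℓ / (D_ℓ • ξξᴴ))`. The minimum is taken in `[0, ∞]`, so that a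
constraint with `D_ℓ • ξξᴴ = 0` imposes no restriction. (All of these numbers vanish only
for `ξ = 0`, as `D₀` is positive definite, and then the result is `0`.) -/
def rescale (S : RelayNetwork G m L) (ξ : VecIdx L → ℂ) : VecIdx L → ℂ :=
  ((⨅ l : Option (Fin L),
      (ENNReal.ofReal (S.Pbar l) / ENNReal.ofReal (matInner (S.D l) (outer ξ))) ^ (1 / 2 : ℝ)).toReal
    : ℂ) • ξ

/-- `w` is an output of the rank-one Gaussian randomization procedure with input `W` and draws
`ξ 0, …, ξ (N-1)`. It is a relation as the factorization `W = w wᴴ` and the maximizing index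
need not be unique. -/
def IsOutput (S : RelayNetwork G m L) (W : Matrix (VecIdx L) (VecIdx L) ℂ) {N : ℕ}
    (ξ : Fin N → VecIdx L → ℂ) (w : VecIdx L → ℂ) : Prop :=
  if W.rank ≤ 1 then W = outer w
  else ∃ n : Fin N,
    (∀ n', S.gam (outer (S.rescale (ξ n'))) ≤ S.gam (outer (S.rescale (ξ n)))) ∧
      w = S.rescale (ξ n)

end RelayNetwork

/-- `ξ ∼ CN(0, W)` under `μ`: `ξ` is a complex random vector with (real) jointly Gaussian
components, mean zero, covariance `E[ξ ξᴴ] = W` and, by circular symmetry, `E[ξ ξᵀ] = 0`. -/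
structure IsCircularGaussian {Ω : Type*} [MeasurableSpace Ω] {n : Type*} [Fintype n]
    (ξ : Ω → n → ℂ) (W : Matrix n n ℂ) (μ : Measure Ω) : Prop where
  gaussian : HasGaussianLaw ξ μ
  mean : ∀ i, ∫ ω, ξ ω i ∂μ = 0
  cov : ∀ i j, ∫ ω, ξ ω i * conj (ξ ω j) ∂μ = W i j
  pseudoCov : ∀ i j, ∫ ω, ξ ω i * ξ ω j ∂μ = 0

/-- Programs over the reals with inputs indexed by `ι`: rational constants, the four arithmetic
operations, square roots, and branching on the sign of a computed number. -/
inductive RealProgram (ι : Type) : Type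
  | input : ι → RealProgram ι
  | const : ℚ → RealProgram ι
  | add : RealProgram ι → RealProgram ι → RealProgram ι
  | sub : RealProgram ι → RealProgram ι → RealProgram ι
  | mul : RealProgram ι → RealProgram ι → RealProgram ι
  | div : RealProgram ι → RealProgram ι → RealProgram ι
  | sqrt : RealProgram ι → RealProgram ι
  | ifNonneg : RealProgram ι → RealProgram ι → RealProgram ι → RealProgram ι

namespace RealProgram

variable {ι : Type}

/-- The value computed by a program. -/
def eval (x : ι → ℝ) : RealProgram ι → ℝ
  | input i => x i
  | const q => (q : ℝ)
  | add a b => a.eval x + b.eval x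
  | sub a b => a.eval x - b.eval x
  | mul a b => a.eval x * b.eval x
  | div a b => a.eval x / b.eval x
  | sqrt a => Real.sqrt (a.eval x)
  | ifNonneg c a b => if 0 ≤ c.eval x then a.eval x else b.eval x

/-- Number of instructions, with unit cost for each; both branches of a test are counted, so this
bounds the number of executed steps. -/
def cost : RealProgram ι → ℕ
  | input _ => 1
  | const _ => 1
  | add a b => a.cost + b.cost + 1
  | sub a b => a.cost + b.cost + 1
  | mul a b => a.cost + b.cost + 1
  | div a b => a.cost + b.cost + 1
  | sqrt a => a.cost + 1
  | ifNonneg c a b => c.cost + a.cost + b.cost + 1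

end RealProgram

/-- The real numbers that describe a relay network. -/
inductive NetworkInput (G : ℕ) (m : Fin G → ℕ) (L : ℕ) : Type
  | power : Fin G → NetworkInput G m L
  | fRe : Fin G → Fin L → NetworkInput G m L
  | fIm : Fin G → Fin L → NetworkInput G m L
  | gRe : (Σ k, Fin (m k)) → Fin L → NetworkInput G m L
  | gIm : (Σ k, Fin (m k)) → Fin L → NetworkInput G m L
  | sigmaR : Fin L → NetworkInput G m L
  | sigmaU : (Σ k, Fin (m k)) → NetworkInput G m L
  | bound : Option (Fin L) → NetworkInput G m L

namespace RelayNetwork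

variable {G : ℕ} {m : Fin G → ℕ} {L : ℕ}

/-- The description of a relay network by real numbers. -/
def encode (S : RelayNetwork G m L) : NetworkInput G m L → ℝ
  | .power j => S.P j
  | .fRe j l => (S.f j l).re
  | .fIm j l => (S.f j l).im
  | .gRe u l => (S.g u l).re
  | .gIm u l => (S.g u l).im
  | .sigmaR l => S.σR l
  | .sigmaU u => S.σU u
  | .bound l => S.Pbar l

end RelayNetwork

/-- An algorithm whose input is a relay network of given dimensions and whose output is a complex
matrix of order `L²`: one real program for the real part and one for the imaginary part of every
entry. -/
structure MatrixSolver (G : ℕ) (m : Fin G → ℕ) (L : ℕ) where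
  re : VecIdx L → VecIdx L → RealProgram (NetworkInput G m L)
  im : VecIdx L → VecIdx L → RealProgram (NetworkInput G m L)

namespace MatrixSolver

variable {G : ℕ} {m : Fin G → ℕ} {L : ℕ}

/-- The matrix computed by the algorithm. -/
def run (A : MatrixSolver G m L) (S : RelayNetwork G m L) : Matrix (VecIdx L) (VecIdx L) ℂ :=
  Matrix.of fun p q => ⟨(A.re p q).eval S.encode, (A.im p q).eval S.encode⟩

/-- The total number of instructions. -/
def cost (A : MatrixSolver G m L) : ℕ :=
  ∑ p, ∑ q, ((A.re p q).cost + (A.im p q).cost)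

end MatrixSolver

end

/-!
For Gaussian randomization, fix one draw `ξ ∼ 𝒞𝒩(0, W)`. A user's signal power is `|aᴴ ξ|²` for a
single vector `a`, hence exponentially distributed and of bounded density. Regressing `ξ` on `aᴴ ξ`
leaves a residual independent of `aᴴ ξ`, so the event that the signal is much smaller than the
interference has its probability bounded by conditioning on the residual and taking one expectation;
only a union bound over the `M` users is lost. A power `D • ξ ξᴴ` is a weighted sum of exponential
variables, so by Jensen's inequality its tail is exponential, and a union bound over the `L + 1`
thresholds costs `log (3 (L + 1))`. Every draw thus succeeds with probability at least `1/6`, and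
the draws are independent.

When `M + L ≤ 3` there are one user and two antennas. Then `A + C` is a Kronecker product of the
received covariance and `g gᴴ`, up to the factor `1 / σ²`, so reception and transmission separate:
a matched filter is optimal at the receive side, and at the transmit side each antenna cancels the
phase of its channel and uses the power that water filling over the two antennas gives it. All of
this is evaluated by arithmetic operations, square roots and comparisons.
-/

section MatInner

open scoped Matrix

variable {n : Type*} [Fintype n]

lemma matInner_comm (A B : Matrix n n ℂ) : matInner A B = matInner B A := by
  rw [matInner, matInner, ← Matrix.conjTranspose_conjTranspose B, ← Matrix.conjTranspose_mul,
    Matrix.trace_conjTranspose, Matrix.conjTranspose_conjTranspose, RCLike.star_def,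
    Complex.conj_re]

lemma matInner_add_left (A B W : Matrix n n ℂ) :
    matInner (A + B) W = matInner A W + matInner B W := by
  simp [matInner, add_mul]

lemma matInner_sub_left (A B W : Matrix n n ℂ) :
    matInner (A - B) W = matInner A W - matInner B W := by
  simp [matInner, sub_mul]

lemma matInner_sub_right (A W W' : Matrix n n ℂ) :
    matInner A (W - W') = matInner A W - matInner A W' := by
  simp [matInner, mul_sub]

lemma matInner_smul_left (c : ℝ) (A W : Matrix n n ℂ) :
    matInner ((c : ℂ) • A) W = c * matInner A W := by
  simp [matInner]

lemma matInner_smul_right (c : ℝ) (A W : Matrix n n ℂ) :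
    matInner A ((c : ℂ) • W) = c * matInner A W := by
  simp [matInner]

lemma matInner_sum_left {ι : Type*} (s : Finset ι) (A : ι → Matrix n n ℂ) (W : Matrix n n ℂ) :
    matInner (∑ i ∈ s, A i) W = ∑ i ∈ s, matInner (A i) W := by
  simp [matInner, Matrix.conjTranspose_sum, Finset.sum_mul, Matrix.trace_sum]

lemma isHermitian_outer {ι : Type*} (w : ι → ℂ) : (outer w).IsHermitian := by
  rw [Matrix.IsHermitian, outer, Matrix.conjTranspose_vecMulVec, star_star]

lemma outer_smul {ι : Type*} (c : ℂ) (w : ι → ℂ) :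
    outer (c • w) = ((Complex.normSq c : ℝ) : ℂ) • outer w := by
  rw [outer, outer, star_smul, Matrix.smul_vecMulVec, Matrix.vecMulVec_smul, smul_smul,
    RCLike.star_def, Complex.mul_conj]

lemma outer_mulVec (w a : n → ℂ) : outer w *ᵥ a = (star w ⬝ᵥ a) • w := by
  rw [outer, Matrix.vecMulVec_mulVec, op_smul_eq_smul]

lemma star_dotProduct_mulVec_eq {l : Type*} [Fintype l] (B : Matrix l n ℂ) (c : l → ℂ)
    (x : n → ℂ) : star c ⬝ᵥ B *ᵥ x = star (Bᴴ *ᵥ c) ⬝ᵥ x := by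
  rw [Matrix.star_mulVec, Matrix.conjTranspose_conjTranspose, Matrix.dotProduct_mulVec]

lemma outer_mulVec_eq_mul_outer_mul {l : Type*} (B : Matrix l n ℂ) (x : n → ℂ) :
    outer (B *ᵥ x) = B * outer x * Bᴴ := by
  rw [outer, outer, Matrix.mul_vecMulVec, Matrix.vecMulVec_mul, Matrix.star_mulVec]

lemma matInner_conj_left {l : Type*} [Fintype l] (C : Matrix l l ℂ) (B : Matrix l n ℂ)
    (W : Matrix n n ℂ) : matInner (Bᴴ * C * B) W = matInner C (B * W * Bᴴ) := by
  rw [matInner, matInner, Matrix.conjTranspose_mul, Matrix.conjTranspose_mul,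
    Matrix.conjTranspose_conjTranspose, Matrix.mul_assoc, Matrix.trace_mul_comm]
  simp only [Matrix.mul_assoc]

lemma matInner_outer_left (a : n → ℂ) (W : Matrix n n ℂ) :
    matInner (outer a) W = (star a ⬝ᵥ W *ᵥ a).re := by
  rw [matInner, (isHermitian_outer a).eq, outer, Matrix.vecMulVec_mul, Matrix.trace_vecMulVec,
    dotProduct_comm, Matrix.dotProduct_mulVec]

lemma matInner_outer_right (A : Matrix n n ℂ) (w : n → ℂ) :
    matInner A (outer w) = (star w ⬝ᵥ A *ᵥ w).re := by
  rw [matInner_comm, matInner_outer_left]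

lemma matInner_outer_outer (a w : n → ℂ) :
    matInner (outer a) (outer w) = Complex.normSq (star a ⬝ᵥ w) := by
  rw [matInner_outer_left, outer_mulVec, dotProduct_smul, smul_eq_mul, Matrix.star_dotProduct,
    RCLike.star_def, ← Complex.normSq_eq_conj_mul_self, Complex.ofReal_re]

lemma posSemidef_outer {ι : Type*} [Finite ι] (w : ι → ℂ) : (outer w).PosSemidef :=
  Matrix.posSemidef_vecMulVec_self_star w

lemma rank_outer_le_one (w : n → ℂ) : (outer w).rank ≤ 1 :=
  Matrix.rank_vecMulVec_le w (star w)

lemma exists_eq_sum_outer {A : Matrix n n ℂ} (hA : A.PosSemidef) :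
    ∃ (s : Finset n) (d : n → n → ℂ), s.card = A.rank ∧ A = ∑ i ∈ s, outer (d i) := by
  classical
  let U : Matrix n n ℂ := hA.isHermitian.eigenvectorUnitary
  let ev : n → ℝ := hA.isHermitian.eigenvalues
  refine ⟨Finset.univ.filter (ev · ≠ 0), fun i => (Real.sqrt (ev i) : ℂ) • U.col i, ?_, ?_⟩
  · rw [hA.isHermitian.rank_eq_card_non_zero_eigs, Fintype.card_subtype]
  · have hspec : A = U * Matrix.diagonal (fun i => (ev i : ℂ)) * Uᴴ := by
      conv_lhs => rw [hA.isHermitian.spectral_theorem, Unitary.conjStarAlgAut_apply]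
      rfl
    have hsum : A = ∑ i, (ev i : ℂ) • outer (U.col i) := by
      ext p q
      rw [hspec, Matrix.mul_apply, Matrix.sum_apply]
      refine Finset.sum_congr rfl fun i _ => ?_
      rw [Matrix.mul_diagonal, Matrix.smul_apply, outer, Matrix.vecMulVec_apply, smul_eq_mul,
        mul_assoc, mul_left_comm]
      rfl
    rw [hsum, ← Finset.sum_filter_of_ne (p := (ev · ≠ 0)) fun i _ hi h0 => hi (by simp [h0])]
    refine Finset.sum_congr rfl fun i _ => ?_
    rw [outer_smul, Complex.normSq_ofReal, Real.mul_self_sqrt (hA.eigenvalues_nonneg i)]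

lemma exists_eq_outer_of_rank_le_one {W : Matrix n n ℂ} (hW : W.PosSemidef) (h : W.rank ≤ 1) :
    ∃ w, W = outer w := by
  obtain ⟨s, d, hs, rfl⟩ := exists_eq_sum_outer hW
  obtain hs0 | hs1 := Nat.le_one_iff_eq_zero_or_eq_one.mp (hs.trans_le h)
  · exact ⟨0, by simp [Finset.card_eq_zero.mp hs0, outer]⟩
  · obtain ⟨i, rfl⟩ := Finset.card_eq_one.mp hs1
    exact ⟨d i, Finset.sum_singleton _ _⟩

lemma matInner_nonneg {A W : Matrix n n ℂ} (hA : A.PosSemidef) (hW : W.PosSemidef) :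
    0 ≤ matInner A W := by
  obtain ⟨s, d, -, rfl⟩ := exists_eq_sum_outer hA
  rw [matInner_sum_left]
  refine Finset.sum_nonneg fun i _ => ?_
  rw [matInner_outer_left]
  exact (Complex.le_def.mp (hW.dotProduct_mulVec_nonneg (d i))).1

lemma matInner_le_matInner {A B W : Matrix n n ℂ} (h : (B - A).PosSemidef) (hW : W.PosSemidef) :
    matInner A W ≤ matInner B W := by
  rw [← sub_nonneg, ← matInner_sub_left]
  exact matInner_nonneg h hW

lemma normSq_add_le_two_mul (x y : ℂ) :
    Complex.normSq (x + y) ≤ 2 * Complex.normSq x + 2 * Complex.normSq y := by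
  simp only [Complex.normSq_apply, Complex.add_re, Complex.add_im]
  nlinarith [sq_nonneg (x.re - y.re), sq_nonneg (x.im - y.im)]

lemma matInner_outer_add_le {C : Matrix n n ℂ} (hC : C.PosSemidef) (x y : n → ℂ) :
    matInner C (outer (x + y)) ≤ 2 * matInner C (outer x) + 2 * matInner C (outer y) := by
  obtain ⟨s, d, -, rfl⟩ := exists_eq_sum_outer hC
  simp only [matInner_sum_left, matInner_outer_outer, dotProduct_add]
  rw [Finset.mul_sum, Finset.mul_sum, ← Finset.sum_add_distrib]
  exact Finset.sum_le_sum fun i _ => normSq_add_le_two_mul _ _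

lemma matInner_outer_smul (C : Matrix n n ℂ) (c : ℂ) (x : n → ℂ) :
    matInner C (outer (c • x)) = Complex.normSq c * matInner C (outer x) := by
  rw [outer_smul, matInner_smul_right]

lemma continuous_matInner_outer (C : Matrix n n ℂ) :
    Continuous fun x : n → ℂ => matInner C (outer x) := by
  unfold matInner outer
  simp only [Matrix.trace, Matrix.diag, Matrix.mul_apply, Matrix.vecMulVec_apply, Pi.star_apply]
  fun_prop

end MatInner

section RealGaussian

lemma gaussianPDFReal_le (m : ℝ) (v : NNReal) (x : ℝ) :
    gaussianPDFReal m v x ≤ (Real.sqrt (2 * Real.pi * v))⁻¹ := by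
  refine mul_le_of_le_one_right (by positivity) (Real.exp_le_one_iff.mpr ?_)
  exact div_nonpos_of_nonpos_of_nonneg (neg_nonpos.mpr (sq_nonneg _)) (by positivity)

lemma gaussianReal_le_smul_volume (m : ℝ) {v : NNReal} (hv : v ≠ 0) :
    gaussianReal m v ≤ ENNReal.ofReal (Real.sqrt (2 * Real.pi * v))⁻¹ • volume := by
  rw [gaussianReal_of_var_ne_zero m hv, ← withDensity_const]
  exact withDensity_mono (.of_forall fun x => ENNReal.ofReal_le_ofReal (gaussianPDFReal_le m v x))

lemma gaussianPDFReal_mul_exp_sq (v : NNReal) (x : ℝ) :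
    gaussianPDFReal 0 v x * Real.exp (x ^ 2 / (4 * v)) =
      Real.sqrt 2 * gaussianPDFReal 0 (2 * v) x := by
  rcases eq_or_ne v 0 with rfl | hv
  · simp [gaussianPDFReal]
  have hexp : -(x - 0) ^ 2 / (2 * (v : ℝ)) + x ^ 2 / (4 * v) = -(x - 0) ^ 2 / (2 * (2 * v)) := by
    field_simp
    ring
  have hsqrt : Real.sqrt (2 * Real.pi * (2 * v)) = Real.sqrt 2 * Real.sqrt (2 * Real.pi * v) := by
    rw [← Real.sqrt_mul (by norm_num)]
    ring_nf
  simp only [gaussianPDFReal, NNReal.coe_mul, NNReal.coe_ofNat]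
  rw [mul_assoc, ← Real.exp_add, hexp, hsqrt, mul_inv, ← mul_assoc (Real.sqrt 2),
    mul_inv_cancel_left₀ (by positivity)]

lemma lintegral_exp_sq_gaussianReal {v : NNReal} (hv : v ≠ 0) :
    ∫⁻ x, ENNReal.ofReal (Real.exp (x ^ 2 / (4 * v))) ∂(gaussianReal 0 v)
      = ENNReal.ofReal (Real.sqrt 2) := by
  rw [gaussianReal_of_var_ne_zero 0 hv, lintegral_withDensity_eq_lintegral_mul _
    (measurable_gaussianPDF 0 v) (by fun_prop)]
  calc ∫⁻ x, gaussianPDF 0 v x * ENNReal.ofReal (Real.exp (x ^ 2 / (4 * v)))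
      = ∫⁻ x, ENNReal.ofReal (Real.sqrt 2) * gaussianPDF 0 (2 * v) x := by
        refine lintegral_congr fun x => ?_
        rw [gaussianPDF, gaussianPDF, ← ENNReal.ofReal_mul (gaussianPDFReal_nonneg _ _ _),
          gaussianPDFReal_mul_exp_sq, ENNReal.ofReal_mul (Real.sqrt_nonneg 2)]
    _ = ENNReal.ofReal (Real.sqrt 2) := by
        rw [lintegral_const_mul _ (measurable_gaussianPDF 0 _),
          lintegral_gaussianPDF_eq_one 0 (by simpa using hv), mul_one]

end RealGaussian

lemma exists_forall_eq_re_dotProduct {n : Type*} [Fintype n] (T : StrongDual ℝ (n → ℂ)) :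
    ∃ a : n → ℂ, ∀ x, T x = (star a ⬝ᵥ x).re := by
  classical
  let T' : Module.Dual ℂ (n → ℂ) := (T.extendRCLike : StrongDual ℂ (n → ℂ))
  refine ⟨star ((dotProductEquiv ℂ n).symm T'), fun x => ?_⟩
  have hdot : (dotProductEquiv ℂ n).symm T' ⬝ᵥ x = T' x :=
    LinearMap.congr_fun ((dotProductEquiv ℂ n).apply_symm_apply T') x
  rw [star_star, hdot]
  exact (StrongDual.re_extendRCLike_apply (𝕜 := ℂ) T x).symm

namespace IsCircularGaussian

open scoped Matrix

variable {Ω : Type*} [MeasurableSpace Ω] {n : Type*} [Fintype n] {ξ : Ω → n → ℂ}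
  {W : Matrix n n ℂ} {μ : Measure Ω}

lemma hasGaussianLaw_dotProduct (h : IsCircularGaussian ξ W μ) (a : n → ℂ) :
    HasGaussianLaw (fun ω => star a ⬝ᵥ ξ ω) μ :=
  h.gaussian.map_fun ((dotProductBilin ℂ ℝ (star a)).toContinuousLinearMap)

lemma hasGaussianLaw_re_dotProduct (h : IsCircularGaussian ξ W μ) (a : n → ℂ) :
    HasGaussianLaw (fun ω => (star a ⬝ᵥ ξ ω).re) μ :=
  (h.hasGaussianLaw_dotProduct a).map_fun Complex.reCLM

lemma memLp_coord (h : IsCircularGaussian ξ W μ) (i : n) : MemLp (fun ω => ξ ω i) 2 μ :=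
  (h.gaussian.map_fun (ContinuousLinearMap.proj (R := ℝ) (φ := fun _ : n => ℂ) i)).memLp_two

lemma integral_dotProduct (h : IsCircularGaussian ξ W μ) (a : n → ℂ) :
    ∫ ω, star a ⬝ᵥ ξ ω ∂μ = 0 := by
  have := h.gaussian.isProbabilityMeasure
  simp only [dotProduct]
  rw [integral_finsetSum _ fun i _ =>
    ((h.memLp_coord i).integrable one_le_two).const_mul _]
  simp only [integral_const_mul, h.mean, mul_zero, Finset.sum_const_zero]

lemma integral_re_dotProduct (h : IsCircularGaussian ξ W μ) (a : n → ℂ) :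
    ∫ ω, (star a ⬝ᵥ ξ ω).re ∂μ = 0 := by
  have := integral_re (h.hasGaussianLaw_dotProduct a).integrable
  rw [h.integral_dotProduct] at this
  simpa using this

lemma integral_dotProduct_mul_conj (h : IsCircularGaussian ξ W μ) (a b : n → ℂ) :
    ∫ ω, (star a ⬝ᵥ ξ ω) * conj (star b ⬝ᵥ ξ ω) ∂μ = star a ⬝ᵥ W *ᵥ b := by
  have hint : ∀ i j, Integrable (fun ω => star a i * b j * (ξ ω i * conj (ξ ω j))) μ := fun i j =>
    ((h.memLp_coord i).integrable_mul (h.memLp_coord j).star).const_mul _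
  calc ∫ ω, (star a ⬝ᵥ ξ ω) * conj (star b ⬝ᵥ ξ ω) ∂μ
      = ∫ ω, ∑ i, ∑ j, star a i * b j * (ξ ω i * conj (ξ ω j)) ∂μ := by
        refine integral_congr_ae (.of_forall fun ω => ?_)
        simp only [dotProduct, map_sum, Finset.sum_mul_sum]
        refine Finset.sum_congr rfl fun i _ => Finset.sum_congr rfl fun j _ => ?_
        simp only [Pi.star_apply, RCLike.star_def, map_mul, Complex.conj_conj]
        ring
    _ = ∑ i, ∑ j, star a i * b j * W i j := by
        rw [integral_finsetSum _ fun i _ => integrable_finsetSum _ fun j _ => hint i j]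
        simp only [integral_finsetSum _ fun j _ => hint _ j, integral_const_mul, h.cov]
    _ = star a ⬝ᵥ W *ᵥ b := by
        simp only [dotProduct, Matrix.mulVec, Finset.mul_sum]
        exact Finset.sum_congr rfl fun i _ => Finset.sum_congr rfl fun j _ => by ring

lemma integral_dotProduct_mul (h : IsCircularGaussian ξ W μ) (a b : n → ℂ) :
    ∫ ω, (star a ⬝ᵥ ξ ω) * (star b ⬝ᵥ ξ ω) ∂μ = 0 := by
  have hint : ∀ i j, Integrable (fun ω => star a i * star b j * (ξ ω i * ξ ω j)) μ := fun i j =>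
    ((h.memLp_coord i).integrable_mul (h.memLp_coord j)).const_mul _
  calc ∫ ω, (star a ⬝ᵥ ξ ω) * (star b ⬝ᵥ ξ ω) ∂μ
      = ∫ ω, ∑ i, ∑ j, star a i * star b j * (ξ ω i * ξ ω j) ∂μ := by
        refine integral_congr_ae (.of_forall fun ω => ?_)
        simp only [dotProduct, Finset.sum_mul_sum]
        exact Finset.sum_congr rfl fun i _ => Finset.sum_congr rfl fun j _ => by ring
    _ = 0 := by
        rw [integral_finsetSum _ fun i _ => integrable_finsetSum _ fun j _ => hint i j]
        simp only [integral_finsetSum _ fun j _ => hint _ j, integral_const_mul, h.pseudoCov,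
          mul_zero, Finset.sum_const_zero]

lemma covariance_re_dotProduct (h : IsCircularGaussian ξ W μ) (a b : n → ℂ) :
    cov[fun ω => (star a ⬝ᵥ ξ ω).re, fun ω => (star b ⬝ᵥ ξ ω).re; μ] =
      (star a ⬝ᵥ W *ᵥ b).re / 2 := by
  have := h.gaussian.isProbabilityMeasure
  have ha := (h.hasGaussianLaw_dotProduct a).memLp_two
  have hb := (h.hasGaussianLaw_dotProduct b).memLp_two
  have hconj : Integrable (fun ω => (star a ⬝ᵥ ξ ω) * conj (star b ⬝ᵥ ξ ω)) μ :=
    ha.integrable_mul hb.star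
  have hmul : Integrable (fun ω => (star a ⬝ᵥ ξ ω) * (star b ⬝ᵥ ξ ω)) μ := ha.integrable_mul hb
  rw [covariance_eq_sub (h.hasGaussianLaw_re_dotProduct a).memLp_two
    (h.hasGaussianLaw_re_dotProduct b).memLp_two, h.integral_re_dotProduct, zero_mul, sub_zero]
  -- `2 (Re x) (Re y) = Re (x ȳ) + Re (x y)`
  calc ∫ ω, (star a ⬝ᵥ ξ ω).re * (star b ⬝ᵥ ξ ω).re ∂μ
      = ∫ ω, ((star a ⬝ᵥ ξ ω) * conj (star b ⬝ᵥ ξ ω) +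
          (star a ⬝ᵥ ξ ω) * (star b ⬝ᵥ ξ ω)).re / 2 ∂μ := by
        refine integral_congr_ae (.of_forall fun ω => ?_)
        simp only [Complex.add_re, Complex.mul_re, Complex.conj_re, Complex.conj_im]
        ring
    _ = (star a ⬝ᵥ W *ᵥ b).re / 2 := by
        have hadd := integral_add hconj hmul
        rw [h.integral_dotProduct_mul_conj, h.integral_dotProduct_mul, add_zero] at hadd
        rw [integral_div, ← hadd]
        exact congrArg (· / 2) (integral_re (hconj.add hmul))

end IsCircularGaussian

lemma volume_setOf_normSq_le {y : ℝ} (hy : 0 ≤ y) :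
    volume {z : ℂ | Complex.normSq z ≤ y} = ENNReal.ofReal (Real.pi * y) := by
  have hball : {z : ℂ | Complex.normSq z ≤ y} = Metric.closedBall 0 (Real.sqrt y) := by
    ext z
    rw [Set.mem_ofPred_eq, mem_closedBall_zero_iff, Complex.normSq_eq_norm_sq,
      Real.le_sqrt (norm_nonneg _) hy]
  rw [hball, Complex.volume_closedBall, ← ENNReal.ofReal_pow (Real.sqrt_nonneg _), Real.sq_sqrt hy,
    mul_comm, ENNReal.ofReal_mul Real.pi_nonneg, ← NNReal.coe_real_pi, ENNReal.ofReal_coe_nnreal]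

namespace IsCircularGaussian

open scoped Matrix

variable {Ω : Type*} [MeasurableSpace Ω] {n : Type*} [Fintype n] {ξ : Ω → n → ℂ}
  {W : Matrix n n ℂ} {μ : Measure Ω}

lemma integrable_normSq_dotProduct (h : IsCircularGaussian ξ W μ) (a : n → ℂ) :
    Integrable (fun ω => Complex.normSq (star a ⬝ᵥ ξ ω)) μ := by
  simp only [Complex.normSq_eq_norm_sq]
  exact (h.hasGaussianLaw_dotProduct a).memLp_two.norm.integrable_sq

lemma ofReal_integral_normSq_dotProduct (h : IsCircularGaussian ξ W μ) (a : n → ℂ) :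
    ((∫ ω, Complex.normSq (star a ⬝ᵥ ξ ω) ∂μ : ℝ) : ℂ) = star a ⬝ᵥ W *ᵥ a := by
  rw [← integral_complex_ofReal, ← h.integral_dotProduct_mul_conj]
  simp only [Complex.mul_conj]

lemma posSemidef (h : IsCircularGaussian ξ W μ) : W.PosSemidef := by
  refine Matrix.PosSemidef.of_dotProduct_mulVec_nonneg ?_ fun a => ?_
  · ext i j
    rw [Matrix.conjTranspose_apply, ← h.cov, ← h.cov, RCLike.star_def, ← integral_conj]
    simp only [map_mul, Complex.conj_conj, mul_comm]
  · rw [← h.ofReal_integral_normSq_dotProduct, Complex.zero_le_real]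
    exact integral_nonneg fun ω => Complex.normSq_nonneg _

lemma lintegral_normSq_dotProduct (h : IsCircularGaussian ξ W μ) (a : n → ℂ) :
    ∫⁻ ω, ENNReal.ofReal (Complex.normSq (star a ⬝ᵥ ξ ω)) ∂μ =
      ENNReal.ofReal (matInner (outer a) W) := by
  rw [← ofReal_integral_eq_lintegral_ofReal (h.integrable_normSq_dotProduct a)
    (.of_forall fun ω => Complex.normSq_nonneg _), matInner_outer_left,
    ← h.ofReal_integral_normSq_dotProduct, Complex.ofReal_re]

lemma indepFun_mulVec (h : IsCircularGaussian ξ W μ) {m k : Type*} [Finite m] [Finite k]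
    {B : Matrix m n ℂ} {C : Matrix k n ℂ} (hBC : B * W * Cᴴ = 0) :
    IndepFun (fun ω => B *ᵥ ξ ω) (fun ω => C *ᵥ ξ ω) μ := by
  have := Fintype.ofFinite m
  have := Fintype.ofFinite k
  refine HasGaussianLaw.indepFun_of_covariance_strongDual
    (h.gaussian.map_fun (((B.mulVecLin.prod C.mulVecLin).restrictScalars ℝ).toContinuousLinearMap))
    fun L₁ L₂ => ?_
  obtain ⟨a, ha⟩ := exists_forall_eq_re_dotProduct L₁
  obtain ⟨b, hb⟩ := exists_forall_eq_re_dotProduct L₂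
  simp only [Function.comp_def, ha, hb, star_dotProduct_mulVec_eq]
  rw [h.covariance_re_dotProduct, ← star_dotProduct_mulVec_eq, Matrix.mulVec_mulVec,
    Matrix.mulVec_mulVec, hBC, Matrix.zero_mulVec, dotProduct_zero, Complex.zero_re, zero_div]

lemma variance_re_dotProduct (h : IsCircularGaussian ξ W μ) (a : n → ℂ) :
    Var[fun ω => (star a ⬝ᵥ ξ ω).re; μ] = matInner (outer a) W / 2 := by
  rw [← covariance_self (h.hasGaussianLaw_re_dotProduct a).aemeasurable,
    h.covariance_re_dotProduct, matInner_outer_left]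

lemma map_re_dotProduct (h : IsCircularGaussian ξ W μ) (a : n → ℂ) :
    μ.map (fun ω => (star a ⬝ᵥ ξ ω).re) = gaussianReal 0 (matInner (outer a) W / 2).toNNReal := by
  rw [(h.hasGaussianLaw_re_dotProduct a).map_eq_gaussianReal, h.integral_re_dotProduct,
    h.variance_re_dotProduct]

lemma aemeasurable_re_dotProduct (h : IsCircularGaussian ξ W μ) (a : n → ℂ) :
    AEMeasurable (fun ω => (star a ⬝ᵥ ξ ω).re) μ :=
  Complex.measurable_re.comp_aemeasurable (h.hasGaussianLaw_dotProduct a).aemeasurable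

lemma aemeasurable_im_dotProduct (h : IsCircularGaussian ξ W μ) (a : n → ℂ) :
    AEMeasurable (fun ω => (star a ⬝ᵥ ξ ω).im) μ :=
  Complex.measurable_im.comp_aemeasurable (h.hasGaussianLaw_dotProduct a).aemeasurable

lemma map_re_im_dotProduct (h : IsCircularGaussian ξ W μ) (a : n → ℂ) :
    μ.map (fun ω => ((star a ⬝ᵥ ξ ω).re, (star a ⬝ᵥ ξ ω).im)) =
      (gaussianReal 0 (matInner (outer a) W / 2).toNNReal).prod
        (gaussianReal 0 (matInner (outer a) W / 2).toNNReal) := by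
  have := h.gaussian.isProbabilityMeasure
  have him : ∀ x : n → ℂ, (star a ⬝ᵥ x).im = (star (Complex.I • a) ⬝ᵥ x).re := fun x => by
    rw [star_smul, smul_dotProduct, smul_eq_mul, RCLike.star_def, Complex.conj_I, neg_mul,
      Complex.neg_re, Complex.I_mul_re, neg_neg]
  have hI : matInner (outer (Complex.I • a)) W = matInner (outer a) W := by
    rw [outer_smul, Complex.normSq_I, Complex.ofReal_one, one_smul]
  have hind : IndepFun (fun ω => (star a ⬝ᵥ ξ ω).re) (fun ω => (star a ⬝ᵥ ξ ω).im) μ := by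
    refine HasGaussianLaw.indepFun_of_covariance_eq_zero
      ((h.hasGaussianLaw_dotProduct a).map_fun (Complex.reCLM.prod Complex.imCLM)) ?_
    simp only [him]
    rw [h.covariance_re_dotProduct, Matrix.mulVec_smul, dotProduct_smul,
      ← h.ofReal_integral_normSq_dotProduct, smul_eq_mul, Complex.I_mul_re, Complex.ofReal_im,
      neg_zero, zero_div]
  rw [hind.map_prod_eq_prod_map_map (h.aemeasurable_re_dotProduct a)
    (h.aemeasurable_im_dotProduct a), h.map_re_dotProduct]
  simp only [him]
  rw [h.map_re_dotProduct, hI]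

lemma lintegral_exp_normSq_dotProduct (h : IsCircularGaussian ξ W μ) {a : n → ℂ}
    (ha : 0 < matInner (outer a) W) :
    ∫⁻ ω, ENNReal.ofReal
      (Real.exp (Complex.normSq (star a ⬝ᵥ ξ ω) / (2 * matInner (outer a) W))) ∂μ = 2 := by
  set τ := matInner (outer a) W
  set v := (τ / 2).toNNReal with hv
  have hvτ : (v : ℝ) = τ / 2 := Real.coe_toNNReal _ (by positivity)
  have hv0 : v ≠ 0 := by simpa [hv] using ha
  let F : ℝ → ENNReal := fun x => ENNReal.ofReal (Real.exp (x ^ 2 / (4 * v)))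
  have hF : Measurable F := by fun_prop
  have hFF : ∀ z : ℂ, ENNReal.ofReal (Real.exp (Complex.normSq z / (2 * τ))) =
      F z.re * F z.im := fun z => by
    rw [← ENNReal.ofReal_mul (Real.exp_nonneg _), ← Real.exp_add, hvτ, Complex.normSq_apply]
    ring_nf
  calc _ = ∫⁻ p, F p.1 * F p.2 ∂μ.map fun ω => ((star a ⬝ᵥ ξ ω).re, (star a ⬝ᵥ ξ ω).im) := by
        rw [lintegral_map' (by fun_prop) ((h.aemeasurable_re_dotProduct a).prodMk
          (h.aemeasurable_im_dotProduct a))]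
        simp only [hFF]
    _ = ENNReal.ofReal (Real.sqrt 2) * ENNReal.ofReal (Real.sqrt 2) := by
        rw [h.map_re_im_dotProduct, lintegral_prod_mul hF.aemeasurable hF.aemeasurable,
          lintegral_exp_sq_gaussianReal hv0]
    _ = 2 := by
        rw [← ENNReal.ofReal_mul (Real.sqrt_nonneg 2), Real.mul_self_sqrt zero_le_two,
          ENNReal.ofReal_ofNat]

lemma measure_normSq_dotProduct_le (h : IsCircularGaussian ξ W μ) {a : n → ℂ}
    (ha : 0 < matInner (outer a) W) (y : ℝ) :
    μ {ω | Complex.normSq (star a ⬝ᵥ ξ ω) ≤ y} ≤ ENNReal.ofReal (y / matInner (outer a) W) := by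
  rcases lt_or_ge y 0 with hy | hy
  · simp [(hy.trans_le (Complex.normSq_nonneg _)).not_ge]
  set τ := matInner (outer a) W
  set v := (τ / 2).toNNReal with hv
  have hvτ : (v : ℝ) = τ / 2 := Real.coe_toNNReal _ (by positivity)
  have hv0 : v ≠ 0 := by simpa [hv] using ha
  set c := ENNReal.ofReal (Real.sqrt (2 * Real.pi * v))⁻¹
  have hcc : c * c = ENNReal.ofReal (Real.pi * τ)⁻¹ := by
    rw [← ENNReal.ofReal_mul (by positivity), ← mul_inv, Real.mul_self_sqrt (by positivity), hvτ]
    ring_nf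
  have hdisc : MeasurableSet {z : ℂ | Complex.normSq z ≤ y} :=
    measurableSet_le Complex.continuous_normSq.measurable measurable_const
  set T : Set (ℝ × ℝ) := Complex.measurableEquivRealProd.symm ⁻¹' {z | Complex.normSq z ≤ y}
  have hT : MeasurableSet T := Complex.measurableEquivRealProd.symm.measurable hdisc
  calc μ {ω | Complex.normSq (star a ⬝ᵥ ξ ω) ≤ y}
      = μ.map (fun ω => ((star a ⬝ᵥ ξ ω).re, (star a ⬝ᵥ ξ ω).im)) T := by
        rw [Measure.map_apply_of_aemeasurable ((h.aemeasurable_re_dotProduct a).prodMk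
          (h.aemeasurable_im_dotProduct a)) hT]
        rfl
    _ ≤ (c • volume).prod (c • volume) T := by
        rw [h.map_re_im_dotProduct]
        exact Measure.prod_mono (gaussianReal_le_smul_volume 0 hv0)
          (gaussianReal_le_smul_volume 0 hv0) T
    _ = c * c * volume {z : ℂ | Complex.normSq z ≤ y} := by
        rw [Measure.prod_smul_left, Measure.prod_smul_right, ← Measure.volume_eq_prod,
          Measure.smul_apply, Measure.smul_apply, smul_eq_mul, smul_eq_mul, mul_assoc,
          Complex.volume_preserving_equiv_real_prod.symm.measure_preimage hdisc.nullMeasurableSet]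
    _ = ENNReal.ofReal (y / τ) := by
        rw [volume_setOf_normSq_le hy, hcc, ← ENNReal.ofReal_mul (by positivity)]
        congr 1
        field_simp

end IsCircularGaussian

lemma lintegral_exp_sum_div_sum_le {Ω ι : Type*} [MeasurableSpace Ω] {μ : Measure Ω}
    {s : Finset ι} (hs : s.Nonempty) {X : ι → Ω → ℝ} {τ : ι → ℝ} {c : ENNReal}
    (hτ : ∀ i ∈ s, 0 < τ i) (hX : ∀ i ∈ s, AEMeasurable (X i) μ)
    (hc : ∀ i ∈ s, ∫⁻ ω, ENNReal.ofReal (Real.exp (X i ω / τ i)) ∂μ ≤ c) :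
    ∫⁻ ω, ENNReal.ofReal (Real.exp ((∑ i ∈ s, X i ω) / ∑ i ∈ s, τ i)) ∂μ ≤ c := by
  set T := ∑ i ∈ s, τ i
  have hT : 0 < T := Finset.sum_pos hτ hs
  have hw : ∀ i ∈ s, 0 ≤ τ i / T := fun i hi => div_nonneg (hτ i hi).le hT.le
  have hw1 : ∑ i ∈ s, τ i / T = 1 := by rw [← Finset.sum_div, div_self hT.ne']
  have hjensen : ∀ ω, Real.exp ((∑ i ∈ s, X i ω) / T) ≤
      ∑ i ∈ s, τ i / T * Real.exp (X i ω / τ i) := fun ω => by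
    have hsum : (∑ i ∈ s, X i ω) / T = ∑ i ∈ s, τ i / T * (X i ω / τ i) := by
      rw [Finset.sum_div]
      refine Finset.sum_congr rfl fun i hi => ?_
      have := (hτ i hi).ne'
      field_simp
    rw [hsum]
    exact convexOn_exp.map_sum_le hw hw1 fun i _ => Set.mem_univ _
  calc ∫⁻ ω, ENNReal.ofReal (Real.exp ((∑ i ∈ s, X i ω) / T)) ∂μ
      ≤ ∫⁻ ω, ∑ i ∈ s, ENNReal.ofReal (τ i / T) * ENNReal.ofReal (Real.exp (X i ω / τ i)) ∂μ := by
        refine lintegral_mono fun ω => (ENNReal.ofReal_le_ofReal (hjensen ω)).trans_eq ?_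
        rw [ENNReal.ofReal_sum_of_nonneg fun i hi => mul_nonneg (hw i hi) (Real.exp_nonneg _)]
        exact Finset.sum_congr rfl fun i hi => ENNReal.ofReal_mul (hw i hi)
    _ = ∑ i ∈ s, ENNReal.ofReal (τ i / T) * ∫⁻ ω, ENNReal.ofReal (Real.exp (X i ω / τ i)) ∂μ := by
        have hm : ∀ i ∈ s, AEMeasurable (fun ω => ENNReal.ofReal (Real.exp (X i ω / τ i))) μ :=
          fun i hi => ((hX i hi).div_const _).exp.ennreal_ofReal
        rw [lintegral_finsetSum' _ fun i hi => (hm i hi).const_mul _]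
        exact Finset.sum_congr rfl fun i hi => lintegral_const_mul'' _ (hm i hi)
    _ ≤ ∑ i ∈ s, ENNReal.ofReal (τ i / T) * c :=
        Finset.sum_le_sum fun i hi => mul_le_mul_right (hc i hi) _
    _ = c := by
        rw [← Finset.sum_mul, ← ENNReal.ofReal_sum_of_nonneg hw, hw1, ENNReal.ofReal_one, one_mul]

lemma measure_normSq_le_of_indepFun {Ω β : Type*} [MeasurableSpace Ω] [MeasurableSpace β]
    {μ : Measure Ω} [IsProbabilityMeasure μ] {S : Ω → ℂ} {Y : Ω → β} (hS : AEMeasurable S μ)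
    (hY : AEMeasurable Y μ) (hind : IndepFun Y S μ) {τ : ℝ}
    (hball : ∀ y : ℝ, μ {ω | Complex.normSq (S ω) ≤ y} ≤ ENNReal.ofReal (y / τ))
    {Z : β → ℝ} (hZ : Measurable Z) :
    μ {ω | Complex.normSq (S ω) ≤ Z (Y ω)} ≤ ∫⁻ ω, ENNReal.ofReal (Z (Y ω) / τ) ∂μ := by
  have hT : MeasurableSet {p : β × ℂ | Complex.normSq p.2 ≤ Z p.1} :=
    measurableSet_le (Complex.continuous_normSq.measurable.comp measurable_snd)
      (hZ.comp measurable_fst)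
  have hdisc : ∀ y : ℝ, μ.map S {z | Complex.normSq z ≤ y} ≤ ENNReal.ofReal (y / τ) := fun y => by
    rw [Measure.map_apply_of_aemeasurable hS
      (measurableSet_le Complex.continuous_normSq.measurable measurable_const)]
    exact hball y
  calc μ {ω | Complex.normSq (S ω) ≤ Z (Y ω)}
      = μ.map (fun ω => (Y ω, S ω)) {p : β × ℂ | Complex.normSq p.2 ≤ Z p.1} := by
        rw [Measure.map_apply_of_aemeasurable (hY.prodMk hS) hT, Set.preimage_ofPred_eq]
    _ = ∫⁻ y, μ.map S {z | Complex.normSq z ≤ Z y} ∂(μ.map Y) := by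
        rw [hind.map_prod_eq_prod_map_map hY hS, Measure.prod_apply hT]
        rfl
    _ ≤ ∫⁻ y, ENNReal.ofReal (Z y / τ) ∂(μ.map Y) := lintegral_mono fun y => hdisc _
    _ = ∫⁻ ω, ENNReal.ofReal (Z (Y ω) / τ) ∂μ :=
        lintegral_map' (hZ.div_const τ).ennreal_ofReal.aemeasurable hY

section Regression

open scoped Matrix

variable {n : Type*} [Fintype n]

/-- The coefficient `b = W a / (aᴴ W a)` of the linear regression `ξ = (aᴴ ξ) b + residual` of a
random vector `ξ` with covariance `W` on its component `aᴴ ξ`; meaningful when `aᴴ W a ≠ 0`. -/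
noncomputable def regressionVec (W : Matrix n n ℂ) (a : n → ℂ) : n → ℂ :=
  ((matInner (outer a) W : ℝ) : ℂ)⁻¹ • W *ᵥ a

/-- The matrix `1 - b aᴴ` that maps `ξ` to the residual of its regression on `aᴴ ξ`. -/
noncomputable def residualMatrix [DecidableEq n] (W : Matrix n n ℂ) (a : n → ℂ) : Matrix n n ℂ :=
  1 - Matrix.vecMulVec (regressionVec W a) (star a)

variable {W : Matrix n n ℂ} {a : n → ℂ}

lemma star_dotProduct_mulVec_self (hW : W.IsHermitian) (a : n → ℂ) :
    star a ⬝ᵥ W *ᵥ a = (matInner (outer a) W : ℝ) := by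
  rw [matInner_outer_left]
  exact Complex.ext rfl (hW.im_star_dotProduct_mulVec_self a)

lemma mulVec_eq_smul_regressionVec (ha : matInner (outer a) W ≠ 0) :
    W *ᵥ a = ((matInner (outer a) W : ℝ) : ℂ) • regressionVec W a := by
  rw [regressionVec, smul_smul, mul_inv_cancel₀ (by exact_mod_cast ha), one_smul]

lemma residualMatrix_mulVec [DecidableEq n] (x : n → ℂ) :
    residualMatrix W a *ᵥ x = x - (star a ⬝ᵥ x) • regressionVec W a := by
  rw [residualMatrix, Matrix.sub_mulVec, Matrix.one_mulVec, Matrix.vecMulVec_mulVec,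
    op_smul_eq_smul]

lemma residualMatrix_mulVec_mulVec [DecidableEq n] (hW : W.IsHermitian)
    (ha : matInner (outer a) W ≠ 0) : residualMatrix W a *ᵥ (W *ᵥ a) = 0 := by
  rw [residualMatrix_mulVec, star_dotProduct_mulVec_self hW, ← mulVec_eq_smul_regressionVec ha,
    sub_self]

lemma residualMatrix_mul_mul_conjTranspose [DecidableEq n] (hW : W.IsHermitian)
    (ha : matInner (outer a) W ≠ 0) :
    residualMatrix W a * W * (residualMatrix W a)ᴴ =
      W - ((matInner (outer a) W : ℝ) : ℂ) • outer (regressionVec W a) := by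
  set τ := matInner (outer a) W
  have hleft : residualMatrix W a * W = W - (τ : ℂ) • outer (regressionVec W a) := by
    have haW : star a ᵥ* W = (τ : ℂ) • star (regressionVec W a) := by
      rw [← hW.eq, ← Matrix.star_mulVec, hW.eq, mulVec_eq_smul_regressionVec ha, star_smul,
        RCLike.star_def, Complex.conj_ofReal]
    rw [residualMatrix, sub_mul, one_mul, Matrix.vecMulVec_mul, haW, Matrix.vecMulVec_smul, outer]
  have hright : residualMatrix W a * W * Matrix.vecMulVec a (star (regressionVec W a)) = 0 := by
    rw [Matrix.mul_vecMulVec, ← Matrix.mulVec_mulVec, residualMatrix_mulVec_mulVec hW ha,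
      Matrix.zero_vecMulVec]
  conv_lhs => enter [2]; rw [residualMatrix, Matrix.conjTranspose_sub, Matrix.conjTranspose_one,
    Matrix.conjTranspose_vecMulVec, star_star]
  rw [mul_sub, mul_one, hright, sub_zero, hleft]

lemma posSemidef_sub_outer_regressionVec (hW : W.PosSemidef) (ha : matInner (outer a) W ≠ 0) :
    (W - ((matInner (outer a) W : ℝ) : ℂ) • outer (regressionVec W a)).PosSemidef := by
  classical
  rw [← residualMatrix_mul_mul_conjTranspose hW.isHermitian ha]
  exact hW.mul_mul_conjTranspose_same _

lemma mul_matInner_outer_regressionVec_le {C : Matrix n n ℂ} (hC : C.PosSemidef)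
    (hW : W.PosSemidef) (ha : matInner (outer a) W ≠ 0) :
    matInner (outer a) W * matInner C (outer (regressionVec W a)) ≤ matInner C W := by
  have h := matInner_nonneg hC (posSemidef_sub_outer_regressionVec hW ha)
  rwa [matInner_sub_right, matInner_smul_right, sub_nonneg] at h

lemma matInner_outer_le_regression [DecidableEq n] {C : Matrix n n ℂ} (hC : C.PosSemidef)
    (x : n → ℂ) :
    matInner C (outer x) ≤
      2 * (matInner (outer a) (outer x) * matInner C (outer (regressionVec W a))) +
        2 * matInner C (outer (residualMatrix W a *ᵥ x)) := by
  have hx : x = (star a ⬝ᵥ x) • regressionVec W a + residualMatrix W a *ᵥ x := by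
    rw [residualMatrix_mulVec, add_sub_cancel]
  rw [matInner_outer_outer, ← matInner_outer_smul]
  conv_lhs => rw [hx]
  exact matInner_outer_add_le hC _ _

lemma mul_normSq_le_of_lt [DecidableEq n] {C : Matrix n n ℂ} (hC : C.PosSemidef)
    (hW : W.PosSemidef) (ha : 0 < matInner (outer a) W) {κ β : ℝ} {x : n → ℂ}
    (hx : κ * (matInner C W + 1) * matInner (outer a) (outer x) <
      matInner (outer a) W * (matInner C (outer x) + β)) :
    (κ - 2) * (matInner C W + 1) * Complex.normSq (star a ⬝ᵥ x) ≤
      matInner (outer a) W * (2 * matInner C (outer (residualMatrix W a *ᵥ x)) + β) := by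
  have hsplit := matInner_outer_le_regression (W := W) (a := a) hC x
  have hr := mul_matInner_outer_regressionVec_le hC hW ha.ne'
  rw [matInner_outer_outer] at hx hsplit
  have hs := Complex.normSq_nonneg (star a ⬝ᵥ x)
  nlinarith [mul_le_mul_of_nonneg_left hr hs, mul_le_mul_of_nonneg_left hsplit ha.le]

end Regression

namespace IsCircularGaussian

open scoped Matrix

variable {Ω : Type*} [MeasurableSpace Ω] {n : Type*} [Fintype n] {ξ : Ω → n → ℂ}
  {W : Matrix n n ℂ} {μ : Measure Ω}

lemma aemeasurable_matInner (h : IsCircularGaussian ξ W μ) (D : Matrix n n ℂ) :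
    AEMeasurable (fun ω => matInner D (outer (ξ ω))) μ :=
  (continuous_matInner_outer D).measurable.comp_aemeasurable h.gaussian.aemeasurable

lemma lintegral_matInner (h : IsCircularGaussian ξ W μ) {D : Matrix n n ℂ} (hD : D.PosSemidef) :
    ∫⁻ ω, ENNReal.ofReal (matInner D (outer (ξ ω))) ∂μ = ENNReal.ofReal (matInner D W) := by
  obtain ⟨s, d, -, rfl⟩ := exists_eq_sum_outer hD
  simp only [matInner_sum_left]
  rw [ENNReal.ofReal_sum_of_nonneg fun i _ => matInner_nonneg (posSemidef_outer _) h.posSemidef]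
  simp only [← h.lintegral_normSq_dotProduct, ← matInner_outer_outer]
  rw [← lintegral_finsetSum' _ fun i _ => (h.aemeasurable_matInner _).ennreal_ofReal]
  exact lintegral_congr fun ω => ENNReal.ofReal_sum_of_nonneg fun i _ =>
    matInner_nonneg (posSemidef_outer _) (posSemidef_outer _)

lemma ae_matInner_eq_zero (h : IsCircularGaussian ξ W μ) {D : Matrix n n ℂ} (hD : D.PosSemidef)
    (h0 : matInner D W = 0) : ∀ᵐ ω ∂μ, matInner D (outer (ξ ω)) = 0 := by
  have hl := h.lintegral_matInner hD
  rw [h0, ENNReal.ofReal_zero, lintegral_eq_zero_iff' (h.aemeasurable_matInner D).ennreal_ofReal]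
    at hl
  filter_upwards [hl] with ω hω
  exact (ENNReal.ofReal_eq_zero.mp hω).antisymm (matInner_nonneg hD (posSemidef_outer _))

lemma lintegral_exp_matInner_le (h : IsCircularGaussian ξ W μ) {D : Matrix n n ℂ}
    (hD : D.PosSemidef) (hpos : 0 < matInner D W) :
    ∫⁻ ω, ENNReal.ofReal (Real.exp (matInner D (outer (ξ ω)) / (2 * matInner D W))) ∂μ ≤ 2 := by
  obtain ⟨s, d, -, rfl⟩ := exists_eq_sum_outer hD
  set τ : n → ℝ := fun i => matInner (outer (d i)) W
  have hτ : ∀ i, 0 ≤ τ i := fun i => matInner_nonneg (posSemidef_outer _) h.posSemidef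
  set t := s.filter (τ · ≠ 0)
  have htpos : ∀ i ∈ t, 0 < τ i := fun i hi => (hτ i).lt_of_ne' (Finset.mem_filter.mp hi).2
  have hsum : matInner (∑ i ∈ s, outer (d i)) W = ∑ i ∈ t, τ i := by
    rw [matInner_sum_left, Finset.sum_filter_ne_zero]
  have hne : t.Nonempty := Finset.nonempty_of_sum_ne_zero (hsum ▸ hpos.ne')
  have hae : ∀ᵐ ω ∂μ, matInner (∑ i ∈ s, outer (d i)) (outer (ξ ω)) =
      ∑ i ∈ t, Complex.normSq (star (d i) ⬝ᵥ ξ ω) := by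
    have hzero : ∀ᵐ ω ∂μ, ∀ i ∈ s, τ i = 0 → Complex.normSq (star (d i) ⬝ᵥ ξ ω) = 0 := by
      simp only [← matInner_outer_outer]
      exact (Finset.eventually_all s).mpr fun i _ => Filter.eventually_imp_distrib_left.mpr
        (h.ae_matInner_eq_zero (posSemidef_outer _))
    filter_upwards [hzero] with ω hω
    simp only [matInner_sum_left, matInner_outer_outer]
    exact (Finset.sum_filter_of_ne fun i hi => mt (hω i hi)).symm
  rw [lintegral_congr_ae (hae.mono fun ω hω => by rw [hω]), hsum, Finset.mul_sum]
  refine lintegral_exp_sum_div_sum_le hne (fun i hi => mul_pos two_pos (htpos i hi))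
    (fun i _ => ?_) fun i hi => (h.lintegral_exp_normSq_dotProduct (htpos i hi)).le
  exact (h.integrable_normSq_dotProduct _).aemeasurable

lemma measure_matInner_gt_le (h : IsCircularGaussian ξ W μ) {D : Matrix n n ℂ}
    (hD : D.PosSemidef) {P β : ℝ} (hP : 0 < P) (hβ : 0 ≤ β) (hDW : matInner D W ≤ P) :
    μ {ω | β * P < matInner D (outer (ξ ω))} ≤ ENNReal.ofReal (2 * Real.exp (-(β / 2))) := by
  rcases (matInner_nonneg hD h.posSemidef).eq_or_lt with h0 | h0
  · refine (measure_mono_null (fun ω hω => ?_) (ae_iff.mp (h.ae_matInner_eq_zero hD h0.symm))).le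
      |>.trans zero_le
    exact ((mul_nonneg hβ hP.le).trans_lt hω).ne'
  have hexp : ∀ ω, β * P < matInner D (outer (ξ ω)) → ENNReal.ofReal (Real.exp (β / 2)) ≤
      ENNReal.ofReal (Real.exp (matInner D (outer (ξ ω)) / (2 * matInner D W))) := fun ω hω => by
    refine ENNReal.ofReal_le_ofReal (Real.exp_le_exp.mpr ?_)
    rw [le_div_iff₀ (by positivity), div_mul_eq_mul_div, mul_left_comm, mul_div_cancel_left₀ _
      two_ne_zero]
    exact (mul_le_mul_of_nonneg_left hDW hβ).trans hω.le
  have hmarkov := mul_meas_ge_le_lintegral₀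
    ((h.aemeasurable_matInner D).div_const (2 * matInner D W)).exp.ennreal_ofReal
    (ENNReal.ofReal (Real.exp (β / 2)))
  rw [Real.exp_neg, ← div_eq_mul_inv, ENNReal.ofReal_div_of_pos (Real.exp_pos _),
    ENNReal.ofReal_ofNat, ENNReal.le_div_iff_mul_le
      (.inl (by simpa using Real.exp_pos _)) (.inl ENNReal.ofReal_ne_top), mul_comm]
  exact (mul_le_mul_right (measure_mono hexp) _).trans
    (hmarkov.trans (h.lintegral_exp_matInner_le hD h0))

lemma indepFun_residual [DecidableEq n] (h : IsCircularGaussian ξ W μ) {a : n → ℂ}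
    (ha : matInner (outer a) W ≠ 0) :
    IndepFun (fun ω => residualMatrix W a *ᵥ ξ ω) (fun ω => star a ⬝ᵥ ξ ω) μ := by
  refine (h.indepFun_mulVec (B := residualMatrix W a) (C := Matrix.replicateRow Unit (star a))
    ?_).comp measurable_id (measurable_pi_apply ())
  rw [Matrix.conjTranspose_replicateRow, star_star, Matrix.mul_assoc,
    ← Matrix.replicateCol_mulVec, ← Matrix.replicateCol_mulVec,
    residualMatrix_mulVec_mulVec h.posSemidef.isHermitian ha, Matrix.replicateCol_zero]

lemma lintegral_residual_add [DecidableEq n] (h : IsCircularGaussian ξ W μ) {a : n → ℂ}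
    (ha : matInner (outer a) W ≠ 0) {C : Matrix n n ℂ} (hC : C.PosSemidef) {c d : ℝ} (hc : 0 ≤ c)
    (hd : 0 ≤ d) :
    ∫⁻ ω, ENNReal.ofReal (c * matInner C (outer (residualMatrix W a *ᵥ ξ ω)) + d) ∂μ =
      ENNReal.ofReal (c * (matInner C W -
        matInner (outer a) W * matInner C (outer (regressionVec W a))) + d) := by
  have := h.gaussian.isProbabilityMeasure
  set B := residualMatrix W a
  have hBCB : (Bᴴ * C * B).PosSemidef := hC.conjTranspose_mul_mul_same B
  have hmean : matInner (Bᴴ * C * B) W =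
      matInner C W - matInner (outer a) W * matInner C (outer (regressionVec W a)) := by
    rw [matInner_conj_left, residualMatrix_mul_mul_conjTranspose h.posSemidef.isHermitian ha,
      matInner_sub_right, matInner_smul_right]
  have hadd : ∀ {x : ℝ}, 0 ≤ x →
      ENNReal.ofReal (c * x + d) = ENNReal.ofReal c * ENNReal.ofReal x + ENNReal.ofReal d :=
    fun hx => by rw [ENNReal.ofReal_add (mul_nonneg hc hx) hd, ENNReal.ofReal_mul hc]
  simp only [outer_mulVec_eq_mul_outer_mul, ← matInner_conj_left]
  rw [← hmean, hadd (matInner_nonneg hBCB h.posSemidef), ← h.lintegral_matInner hBCB,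
    lintegral_congr fun ω => hadd (matInner_nonneg hBCB (posSemidef_outer (ξ ω))),
    lintegral_add_right _ measurable_const, lintegral_const_mul'' _
      (h.aemeasurable_matInner _).ennreal_ofReal, lintegral_const, measure_univ, mul_one]

lemma measure_rankOne_lt_le (h : IsCircularGaussian ξ W μ) {a : n → ℂ}
    (ha : 0 < matInner (outer a) W) {C : Matrix n n ℂ} (hC : C.PosSemidef) {κ β : ℝ} (hκ : 2 < κ)
    (hβ : 2 ≤ β) :
    μ {ω | κ * (matInner C W + 1) * matInner (outer a) (outer (ξ ω)) <
        matInner (outer a) W * (matInner C (outer (ξ ω)) + β)} ≤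
      ENNReal.ofReal (β / (κ - 2)) := by
  classical
  have := h.gaussian.isProbabilityMeasure
  have hind := h.indepFun_residual ha.ne'
  set q := matInner C W
  have hq0 : 0 ≤ q := matInner_nonneg hC h.posSemidef
  set τ := matInner (outer a) W
  set r := matInner C (outer (regressionVec W a))
  have hr0 : 0 ≤ r := matInner_nonneg hC (posSemidef_outer _)
  set B := residualMatrix W a
  have : 0 < κ - 2 := sub_pos.mpr hκ
  let Z : (n → ℂ) → ℝ := fun y => τ * (2 * matInner C (outer y) + β) / ((κ - 2) * (q + 1))
  have hZ : Measurable Z := by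
    have := (continuous_matInner_outer C).measurable
    fun_prop
  calc _ ≤ μ {ω | Complex.normSq (star a ⬝ᵥ ξ ω) ≤ Z (B *ᵥ ξ ω)} := by
        refine measure_mono fun ω hω => ?_
        rw [Set.mem_ofPred_eq, le_div_iff₀' (by positivity)]
        exact mul_normSq_le_of_lt hC h.posSemidef ha hω
    _ ≤ ∫⁻ ω, ENNReal.ofReal (Z (B *ᵥ ξ ω) / τ) ∂μ :=
        measure_normSq_le_of_indepFun (h.hasGaussianLaw_dotProduct a).aemeasurable
          (by have := h.gaussian.aemeasurable; fun_prop) hind (h.measure_normSq_dotProduct_le ha) hZ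
    _ = ∫⁻ ω, ENNReal.ofReal (2 / ((κ - 2) * (q + 1)) * matInner C (outer (B *ᵥ ξ ω)) +
          β / ((κ - 2) * (q + 1))) ∂μ := by
        refine lintegral_congr fun ω => congrArg _ ?_
        simp only [Z]
        field_simp
    _ = ENNReal.ofReal (2 / ((κ - 2) * (q + 1)) * (q - τ * r) + β / ((κ - 2) * (q + 1))) :=
        h.lintegral_residual_add ha.ne' hC (by positivity) (by positivity)
    _ ≤ ENNReal.ofReal (β / (κ - 2)) := by
        refine ENNReal.ofReal_le_ofReal ?_
        rw [div_mul_eq_mul_div, ← add_div, ← div_div, div_right_comm]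
        gcongr
        rw [div_le_iff₀ (by positivity)]
        nlinarith [mul_nonneg ha.le hr0]

end IsCircularGaussian

lemma ofReal_one_sub_pow_le_measure {Ω β : Type*} [MeasurableSpace Ω] [MeasurableSpace β]
    {μ : Measure Ω} [IsProbabilityMeasure μ] {N : ℕ} {ξ : Fin N → Ω → β} (hind : iIndepFun ξ μ)
    {E : Set β} (hE : MeasurableSet E) {p : ℝ} (hp : 0 ≤ p)
    (hbad : ∀ n, μ (ξ n ⁻¹' Eᶜ) ≤ ENNReal.ofReal p) {s : Set Ω} (hs : ∀ n, ξ n ⁻¹' E ⊆ s) :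
    ENNReal.ofReal (1 - p ^ N) ≤ μ s := by
  have hcompl : sᶜ ⊆ ⋂ n, ξ n ⁻¹' Eᶜ :=
    Set.subset_iInter fun n => Set.compl_subset_compl.mpr (hs n)
  have hprod : μ (⋂ n, ξ n ⁻¹' Eᶜ) ≤ ENNReal.ofReal (p ^ N) := by
    rw [hind.meas_iInter fun n => ⟨Eᶜ, hE.compl, rfl⟩]
    refine (Finset.prod_le_prod' fun n _ => hbad n).trans_eq ?_
    rw [Finset.prod_const, Finset.card_univ, Fintype.card_fin, ENNReal.ofReal_pow hp]
  rw [ENNReal.ofReal_sub _ (pow_nonneg hp N), ENNReal.ofReal_one, tsub_le_iff_right]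
  calc (1 : ENNReal) = μ (s ∪ sᶜ) := by rw [Set.union_compl_self, measure_univ]
    _ ≤ μ s + μ sᶜ := measure_union_le _ _
    _ ≤ μ s + ENNReal.ofReal (p ^ N) := by gcongr; exact (measure_mono hcompl).trans hprod

lemma posSemidef_ofReal_smul {n : Type*} {A : Matrix n n ℂ} (hA : A.PosSemidef) {c : ℝ}
    (hc : 0 ≤ c) : ((c : ℂ) • A).PosSemidef :=
  hA.smul (Complex.zero_le_real.mpr hc)

lemma div_le_mul_div_rescaled {a c A C κ β t : ℝ} (hc : 0 ≤ c) (hA : 0 ≤ A)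
    (hC : 0 ≤ C) (ht : 1 ≤ β * t ^ 2) (h : A * (c + β) ≤ κ * (C + 1) * a) :
    A / (C + 1) ≤ κ * (t ^ 2 * a / (t ^ 2 * c + 1)) := by
  rw [← mul_div_assoc, div_le_div_iff₀ (by positivity) (by positivity)]
  nlinarith [mul_le_mul_of_nonneg_left ht hA, mul_le_mul_of_nonneg_left h (sq_nonneg t)]

lemma one_le_log_three_mul {x : ℝ} (hx : 0 ≤ x) : 1 ≤ Real.log (3 * (x + 1)) := by
  rw [Real.le_log_iff_exp_le (by positivity)]
  linarith [Real.exp_one_lt_d9]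

lemma two_le_log_three_mul {x : ℝ} (hx : 2 ≤ x) : 2 ≤ Real.log (3 * (x + 1)) := by
  rw [Real.le_log_iff_exp_le (by positivity)]
  calc Real.exp 2 = Real.exp 1 * Real.exp 1 := by rw [← Real.exp_add, one_add_one_eq_two]
    _ ≤ 3 * (x + 1) := by nlinarith [Real.exp_one_lt_d9, Real.exp_pos 1]

lemma failureProb_le {x M : ℝ} (hx : 0 ≤ x) (hM : 1 ≤ M) {β κ : ℝ}
    (hβ : β = 2 * Real.log (3 * (x + 1)))
    (hκ : κ = 48 * M * (Real.log (3 * (x + 1)) + 1 / 6)) :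
    (x + 1) * (2 * Real.exp (-(β / 2))) + M * (β / (κ - 2)) ≤ 5 / 6 := by
  have hlog := one_le_log_three_mul hx
  have hpower : (x + 1) * (2 * Real.exp (-(β / 2))) = 2 / 3 := by
    rw [hβ, mul_div_cancel_left₀ _ two_ne_zero, Real.exp_neg, Real.exp_log (by positivity)]
    field_simp
  have huser : M * (β / (κ - 2)) ≤ 1 / 6 := by
    rw [← mul_div_assoc, div_le_div_iff₀ (by nlinarith) (by norm_num), hβ, hκ]
    nlinarith
  linarith

namespace RelayNetwork

variable {G : ℕ} {m : Fin G → ℕ} {L : ℕ} (S : RelayNetwork G m L)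
  {W : Matrix (VecIdx L) (VecIdx L) ℂ}

lemma posDef_noiseCov : S.noiseCov.PosDef :=
  Matrix.PosDef.diagonal fun l => Complex.zero_lt_real.mpr (pow_pos (S.σR_pos l) 2)

lemma posDef_rxCov : S.rxCov.PosDef :=
  Matrix.PosDef.posSemidef_add (Matrix.posSemidef_sum _ fun j _ =>
    posSemidef_ofReal_smul (posSemidef_outer _) (S.P_nonneg j)) S.posDef_noiseCov

lemma posSemidef_A (u : Σ k, Fin (m k)) : (S.A u).PosSemidef :=
  posSemidef_ofReal_smul (posSemidef_outer _) (div_nonneg (S.P_nonneg _) (sq_nonneg _))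

lemma posSemidef_C (u : Σ k, Fin (m k)) : (S.C u).PosSemidef :=
  (Matrix.posSemidef_sum _ fun j _ =>
    posSemidef_ofReal_smul (posSemidef_outer _) (div_nonneg (S.P_nonneg _) (sq_nonneg _))).add
  (posSemidef_ofReal_smul (S.posDef_noiseCov.posSemidef.kronecker (posSemidef_outer _))
    (by positivity))

lemma posSemidef_D : ∀ l, (S.D l).PosSemidef
  | none => S.posDef_rxCov.posSemidef.kronecker Matrix.PosSemidef.one
  | some l => by
    refine S.posDef_rxCov.posSemidef.kronecker ?_
    rw [← Matrix.diagonal_single]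
    exact Matrix.PosSemidef.diagonal (Pi.single_nonneg.mpr zero_le_one)

lemma matInner_D_none_pos {x : VecIdx L → ℂ} (hx : x ≠ 0) :
    0 < matInner (S.D none) (outer x) := by
  have hD : (S.D none).PosDef := S.posDef_rxCov.kronecker Matrix.PosDef.one
  rw [matInner_outer_right]
  exact (Complex.lt_def.mp (hD.dotProduct_mulVec_pos hx)).1

lemma gam_nonneg (hW : W.PosSemidef) : 0 ≤ S.gam W :=
  Real.iInf_nonneg fun u => div_nonneg (matInner_nonneg (S.posSemidef_A u) hW)
    (add_nonneg (matInner_nonneg (S.posSemidef_C u) hW) zero_le_one)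

lemma gam_le (u : Σ k, Fin (m k)) (W : Matrix (VecIdx L) (VecIdx L) ℂ) :
    S.gam W ≤ matInner (S.A u) W / (matInner (S.C u) W + 1) :=
  ciInf_le (Set.finite_range _).bddBelow u

lemma rate_sub_rate_le {W' : Matrix (VecIdx L) (VecIdx L) ℂ} (hW : W.PosSemidef)
    (hW' : W'.PosSemidef) {κ : ℝ} (hκ : 1 ≤ κ) (h : S.gam W ≤ κ * S.gam W') :
    S.rate W - S.rate W' ≤ Real.log κ := by
  have h0 := S.gam_nonneg hW
  have h1 := S.gam_nonneg hW'
  rw [rate, rate, sub_le_iff_le_add, ← Real.log_mul (by positivity) (by positivity)]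
  exact Real.log_le_log (by positivity) (by nlinarith)

lemma exists_rescale_eq_smul {x : VecIdx L → ℂ} (hx : x ≠ 0) {β : ℝ} (hβ : 0 < β)
    (h : ∀ l, matInner (S.D l) (outer x) ≤ β * S.Pbar l) :
    ∃ t : ℝ, 1 ≤ β * t ^ 2 ∧ S.rescale x = (t : ℂ) • x := by
  refine ⟨_, ?_, rfl⟩
  set F : Option (Fin L) → ENNReal := fun l =>
    (ENNReal.ofReal (S.Pbar l) / ENNReal.ofReal (matInner (S.D l) (outer x))) ^ (1 / 2 : ℝ)
  have hfin : (⨅ l, F l) ≠ ⊤ := by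
    refine ne_top_of_le_ne_top (ENNReal.rpow_ne_top_of_nonneg one_half_pos.le
      (ENNReal.div_ne_top ENNReal.ofReal_ne_top ?_)) (iInf_le F none)
    exact (ENNReal.ofReal_pos.mpr (S.matInner_D_none_pos hx)).ne'
  have hle : ENNReal.ofReal (Real.sqrt β⁻¹) ≤ ⨅ l, F l := by
    refine le_iInf fun l => ?_
    rw [Real.sqrt_eq_rpow, ← ENNReal.ofReal_rpow_of_nonneg (by positivity) (by positivity)]
    refine ENNReal.rpow_le_rpow ?_ (by positivity)
    rw [ENNReal.le_div_iff_mul_le (.inr (ENNReal.ofReal_pos.mpr (S.Pbar_pos l)).ne')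
      (.inl ENNReal.ofReal_ne_top), ← ENNReal.ofReal_mul (by positivity)]
    exact ENNReal.ofReal_le_ofReal ((inv_mul_le_iff₀ hβ).mpr (h l))
  have hsqrt := ENNReal.toReal_mono hfin hle
  rw [ENNReal.toReal_ofReal (Real.sqrt_nonneg _)] at hsqrt
  exact (inv_le_iff_one_le_mul₀' hβ).mp (Real.sqrt_le_iff.mp hsqrt).2

/-- The draws `x` whose powers `D_ℓ • xxᴴ` are at most `β` times the thresholds and for which every
user's SINR at noise level `β` is at least the SINR at `W` divided by `κ`. (The latter inequality
is stated with denominators cleared.) -/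
def goodDraws (W : Matrix (VecIdx L) (VecIdx L) ℂ) (β κ : ℝ) : Set (VecIdx L → ℂ) :=
  {x | (∀ l, matInner (S.D l) (outer x) ≤ β * S.Pbar l) ∧
    ∀ u, matInner (S.A u) W * (matInner (S.C u) (outer x) + β) ≤
      κ * (matInner (S.C u) W + 1) * matInner (S.A u) (outer x)}

lemma measurableSet_goodDraws (W : Matrix (VecIdx L) (VecIdx L) ℂ) (β κ : ℝ) :
    MeasurableSet (S.goodDraws W β κ) := by
  have hcont := fun M => continuous_matInner_outer (n := VecIdx L) M
  simp only [goodDraws, Set.ofPred_and, Set.ofPred_forall]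
  exact .inter
    (.iInter fun l => (isClosed_le (hcont _) continuous_const).measurableSet)
    (.iInter fun u => (isClosed_le (continuous_const.mul ((hcont _).add continuous_const))
      (continuous_const.mul (hcont _))).measurableSet)

lemma gam_le_of_mem_goodDraws [Nonempty (Σ k, Fin (m k))] (hW : W.PosSemidef) {β κ : ℝ}
    (hβ : 0 < β) (hκ : 0 < κ) {x : VecIdx L → ℂ} (hx : x ∈ S.goodDraws W β κ) :
    S.gam W ≤ κ * S.gam (outer (S.rescale x)) := by
  obtain ⟨hD, hA⟩ := hx
  have hW0 := fun u => matInner_nonneg (S.posSemidef_A u) hW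
  rcases eq_or_ne x 0 with rfl | hx0
  · obtain ⟨u⟩ := ‹Nonempty (Σ k, Fin (m k))›
    have hzero : ∀ B : Matrix (VecIdx L) (VecIdx L) ℂ, matInner B (outer 0) = 0 := fun B => by
      simp [matInner, outer]
    have hAu : matInner (S.A u) W = 0 := by
      have hu := hA u
      rw [hzero, hzero, zero_add, mul_zero] at hu
      exact (nonpos_of_mul_nonpos_left hu hβ).antisymm (hW0 u)
    calc S.gam W ≤ 0 := (S.gam_le u W).trans_eq (by rw [hAu, zero_div])
      _ ≤ _ := mul_nonneg hκ.le (S.gam_nonneg (posSemidef_outer _))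
  · obtain ⟨t, ht, hr⟩ := S.exists_rescale_eq_smul hx0 hβ hD
    rw [← div_le_iff₀' hκ]
    refine le_ciInf fun u => ?_
    rw [div_le_iff₀' hκ, hr, matInner_outer_smul, matInner_outer_smul, Complex.normSq_ofReal,
      ← pow_two]
    exact (S.gam_le u W).trans (div_le_mul_div_rescaled
      (matInner_nonneg (S.posSemidef_C u) (posSemidef_outer x)) (hW0 u)
      (matInner_nonneg (S.posSemidef_C u) hW) ht (hA u))

section GaussianDraws

variable {Ω : Type*} [MeasurableSpace Ω] {μ : Measure Ω} {ξ : Ω → VecIdx L → ℂ} {β κ : ℝ}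

lemma measure_userFailure_le (hξ : IsCircularGaussian ξ W μ) (hβ : 2 ≤ β) (hκ : 2 < κ)
    (u : Σ k, Fin (m k)) :
    μ {ω | κ * (matInner (S.C u) W + 1) * matInner (S.A u) (outer (ξ ω)) <
        matInner (S.A u) W * (matInner (S.C u) (outer (ξ ω)) + β)} ≤
      ENNReal.ofReal (β / (κ - 2)) := by
  set c := S.P u.1 / S.σU u ^ 2
  have hc0 : 0 ≤ c := div_nonneg (S.P_nonneg _) (sq_nonneg _)
  set a := S.chan u.1 u
  have hA : ∀ B, matInner (S.A u) B = c * matInner (outer a) B := matInner_smul_left c _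
  have hscale : ∀ ω, κ * (matInner (S.C u) W + 1) * matInner (S.A u) (outer (ξ ω)) <
      matInner (S.A u) W * (matInner (S.C u) (outer (ξ ω)) + β) →
      κ * (matInner (S.C u) W + 1) * matInner (outer a) (outer (ξ ω)) <
        matInner (outer a) W * (matInner (S.C u) (outer (ξ ω)) + β) := fun ω hω => by
    rw [hA, hA, mul_left_comm, mul_assoc c] at hω
    exact lt_of_mul_lt_mul_left hω hc0
  rcases (matInner_nonneg (posSemidef_outer a) hξ.posSemidef).eq_or_lt with h0 | h0
  · refine (measure_mono_null (fun ω hω => ?_) (measure_empty (μ := μ))).le.trans zero_le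
    have hlt := hscale ω hω
    rw [← h0, zero_mul] at hlt
    have hC := matInner_nonneg (S.posSemidef_C u) hξ.posSemidef
    exact hlt.not_ge (mul_nonneg (by positivity)
      (matInner_nonneg (posSemidef_outer a) (posSemidef_outer (ξ ω))))
  · exact (measure_mono hscale).trans (hξ.measure_rankOne_lt_le h0 (S.posSemidef_C u) hκ hβ)

lemma measure_compl_goodDraws_le (hξ : IsCircularGaussian ξ W μ) (hW : W ∈ S.sdrFeasible)
    (hβ : 2 ≤ β) (hκ : 2 < κ) :
    μ (ξ ⁻¹' (S.goodDraws W β κ)ᶜ) ≤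
      ENNReal.ofReal ((L + 1) * (2 * Real.exp (-(β / 2))) + (∑ k, m k : ℕ) * (β / (κ - 2))) := by
  have hsub : ξ ⁻¹' (S.goodDraws W β κ)ᶜ ⊆
      (⋃ l, {ω | β * S.Pbar l < matInner (S.D l) (outer (ξ ω))}) ∪
      ⋃ u, {ω | κ * (matInner (S.C u) W + 1) * matInner (S.A u) (outer (ξ ω)) <
        matInner (S.A u) W * (matInner (S.C u) (outer (ξ ω)) + β)} := by
    intro ω hω
    by_contra hcon
    simp only [Set.mem_union, Set.mem_iUnion, not_or, not_exists] at hcon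
    exact hω ⟨fun l => not_lt.mp (hcon.1 l), fun u => not_lt.mp (hcon.2 u)⟩
  have : 0 < κ - 2 := sub_pos.mpr hκ
  rw [ENNReal.ofReal_add (by positivity) (by positivity)]
  refine (measure_mono hsub).trans ((measure_union_le _ _).trans (add_le_add ?_ ?_))
  · refine (measure_iUnion_fintype_le _ _).trans ((Finset.sum_le_sum fun l _ =>
      hξ.measure_matInner_gt_le (S.posSemidef_D l) (S.Pbar_pos l) (by positivity)
        (hW.2 l)).trans_eq ?_)
    rw [Finset.sum_const, Finset.card_univ, Fintype.card_option, Fintype.card_fin,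
      ← ENNReal.ofReal_nsmul, nsmul_eq_mul, Nat.cast_add_one]
  · refine (measure_iUnion_fintype_le _ _).trans ((Finset.sum_le_sum fun u _ =>
      S.measure_userFailure_le hξ hβ hκ u).trans_eq ?_)
    rw [Finset.sum_const, Finset.card_univ, Fintype.card_sigma, ← ENNReal.ofReal_nsmul,
      nsmul_eq_mul]
    simp only [Fintype.card_fin]

end GaussianDraws

lemma exists_isOutput (hW : W.PosSemidef) {N : ℕ} (hN : 1 ≤ N) (ξ : Fin N → VecIdx L → ℂ) :
    ∃ w, S.IsOutput W ξ w := by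
  by_cases hrank : W.rank ≤ 1
  · simpa only [IsOutput, if_pos hrank] using exists_eq_outer_of_rank_le_one hW hrank
  · have : NeZero N := ⟨Nat.one_le_iff_ne_zero.mp hN⟩
    obtain ⟨n, hn⟩ := Finite.exists_max fun n => S.gam (outer (S.rescale (ξ n)))
    exact ⟨S.rescale (ξ n), by rw [IsOutput, if_neg hrank]; exact ⟨n, hn, rfl⟩⟩

variable {S} in
lemma IsOutput.eq_outer (hrank : W.rank ≤ 1) {N : ℕ} {ξ : Fin N → VecIdx L → ℂ}
    {w : VecIdx L → ℂ} (hw : S.IsOutput W ξ w) : W = outer w := by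
  rwa [IsOutput, if_pos hrank] at hw

variable {S} in
lemma IsOutput.gam_rescale_le (hrank : ¬W.rank ≤ 1) {N : ℕ} {ξ : Fin N → VecIdx L → ℂ}
    {w : VecIdx L → ℂ} (hw : S.IsOutput W ξ w) (n : Fin N) :
    S.gam (outer (S.rescale (ξ n))) ≤ S.gam (outer w) := by
  rw [IsOutput, if_neg hrank] at hw
  obtain ⟨n', hmax, rfl⟩ := hw
  exact hmax n

lemma two_le_of_one_lt_rank (hrank : 1 < W.rank) : 2 ≤ L := by
  have hcard := W.rank_le_card_width
  rw [Fintype.card_prod, Fintype.card_fin] at hcard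
  by_contra! hL
  nlinarith

theorem randomization_gap (hM : 1 ≤ ∑ k, m k) (hW : W ∈ S.sdrFeasible) {N : ℕ} {Ω : Type*}
    [MeasurableSpace Ω] {μ : Measure Ω} [IsProbabilityMeasure μ] {ξ : Fin N → Ω → VecIdx L → ℂ}
    (hξ : ∀ n, IsCircularGaussian (ξ n) W μ) (hind : iIndepFun ξ μ) {w : Ω → VecIdx L → ℂ}
    (hw : ∀ ω, S.IsOutput W (fun n => ξ n ω) (w ω)) :
    ENNReal.ofReal (1 - (5 / 6 : ℝ) ^ N) ≤
      μ {ω | S.rate W - S.rate (outer (w ω)) ≤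
        Real.log ((∑ k, m k : ℕ) : ℝ) + Real.log (Real.log (3 * ((L : ℝ) + 1)) + 1 / 6)
          + Real.log 48} := by
  set ℓ := Real.log (3 * ((L : ℝ) + 1))
  have hℓ1 : 1 ≤ ℓ := one_le_log_three_mul L.cast_nonneg
  have hM1 : (1 : ℝ) ≤ (∑ k, m k : ℕ) := Nat.one_le_cast.mpr hM
  set κ : ℝ := 48 * (∑ k, m k : ℕ) * (ℓ + 1 / 6) with hκ
  have hκ2 : 2 < κ := by nlinarith
  have hlogκ : Real.log (∑ k, m k : ℕ) + Real.log (ℓ + 1 / 6) + Real.log 48 = Real.log κ := by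
    rw [hκ, Real.log_mul (by positivity) (by positivity),
      Real.log_mul (by positivity) (by positivity)]
    ring
  have hE : MeasurableSet (S.goodDraws W (2 * ℓ) κ) := S.measurableSet_goodDraws W _ _
  rw [hlogκ]
  by_cases hrank : W.rank ≤ 1
  · simp only [← (hw _).eq_outer hrank, sub_self, Real.log_nonneg (by linarith : 1 ≤ κ),
      Set.ofPred_true, measure_univ, ENNReal.ofReal_le_one, tsub_le_iff_right,
      le_add_iff_nonneg_right]
    positivity
  · have : Nonempty (Σ k, Fin (m k)) := by
      rwa [← Fintype.card_pos_iff, Fintype.card_sigma, Finset.sum_congr rfl fun _ _ =>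
        Fintype.card_fin _]
    have hβ : 2 ≤ ℓ :=
      two_le_log_three_mul (by exact_mod_cast two_le_of_one_lt_rank (not_le.mp hrank))
    refine ofReal_one_sub_pow_le_measure hind hE (by norm_num) (fun n => ?_) fun n ω hω => ?_
    · exact (S.measure_compl_goodDraws_le (hξ n) hW (by linarith) hκ2).trans
        (ENNReal.ofReal_le_ofReal (failureProb_le L.cast_nonneg hM1 rfl rfl))
    · have hgam := S.gam_le_of_mem_goodDraws hW.1 (by linarith) (by linarith) hω
      exact S.rate_sub_rate_le hW.1 (posSemidef_outer _) (by linarith)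
        (hgam.trans (mul_le_mul_of_nonneg_left ((hw ω).gam_rescale_le hrank n) (by linarith)))

end RelayNetwork

section PhaseAligned

variable {n : Type*}

/-- The vector with amplitudes `p` and the phases of `g`: the beamformer for the channel `g` whose
contributions add up coherently. Entries with `g l = 0` vanish. -/
noncomputable def phaseAligned (g : n → ℂ) (p : n → ℝ) (l : n) : ℂ :=
  p l * (g l / (‖g l‖ : ℂ))

lemma normSq_phaseAligned_le (g : n → ℂ) (p : n → ℝ) (l : n) :
    Complex.normSq (phaseAligned g p l) ≤ p l ^ 2 := by
  rw [phaseAligned, Complex.normSq_mul, Complex.normSq_ofReal, Complex.normSq_div,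
    Complex.normSq_ofReal, Complex.normSq_eq_norm_sq, ← pow_two, ← pow_two]
  exact mul_le_of_le_one_right (sq_nonneg _) (div_self_le_one _)

variable [Fintype n]

lemma star_dotProduct_phaseAligned (g : n → ℂ) (p : n → ℝ) :
    star g ⬝ᵥ phaseAligned g p = (∑ l, ‖g l‖ * p l : ℝ) := by
  rw [dotProduct, Complex.ofReal_sum]
  refine Finset.sum_congr rfl fun l _ => ?_
  rw [phaseAligned, Pi.star_apply, RCLike.star_def, mul_left_comm, ← mul_div_assoc,
    Complex.conj_mul', pow_two, mul_self_div_self, Complex.ofReal_mul, mul_comm]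

end PhaseAligned

section Quadratic

open scoped Matrix

variable {n : Type*} [Fintype n]

lemma posSemidef_sub_outer_mulVec {K : Matrix n n ℂ} (hK : K.PosSemidef) {z : n → ℂ}
    (hz : matInner (outer z) K = 1) : (K - outer (K *ᵥ z)).PosSemidef := by
  have h := posSemidef_sub_outer_regressionVec hK (a := z) (hz.trans_ne one_ne_zero)
  simpa only [regressionVec, hz, Complex.ofReal_one, inv_one, one_smul] using h

lemma posSemidef_diagonal_sub_outer [DecidableEq n] {g : n → ℂ} {p r : n → ℝ} (hr : ∀ l, 0 ≤ r l)
    (hg : ∀ l, ‖g l‖ = r l * p l) :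
    (Matrix.diagonal (fun l => (((∑ i, ‖g i‖ * p i) * r l : ℝ) : ℂ)) - outer g).PosSemidef := by
  set T := ∑ i, ‖g i‖ * p i with hT
  have hterm : ∀ l, 0 ≤ ‖g l‖ * p l := fun l => by
    rw [hg, mul_assoc]
    exact mul_nonneg (hr l) (mul_self_nonneg _)
  rcases (Finset.sum_nonneg fun l _ => hterm l : 0 ≤ T).eq_or_lt with hT0 | hT0
  · have hg0 : g = 0 := funext fun l => by
      have hl := (Finset.sum_eq_zero_iff_of_nonneg fun i _ => hterm i).mp hT0.symm l
        (Finset.mem_univ l)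
      rcases mul_eq_zero.mp hl with h | h
      · exact norm_eq_zero.mp h
      · exact norm_eq_zero.mp (by rw [hg, h, mul_zero])
    simp [hT, hg0, outer, Matrix.PosSemidef.zero]
  set K : Matrix n n ℂ := Matrix.diagonal fun l => ((T * r l : ℝ) : ℂ)
  have hK : K.PosSemidef := Matrix.PosSemidef.diagonal fun l =>
    Complex.zero_le_real.mpr (mul_nonneg hT0.le (hr l))
  have hT' : (T : ℂ) ≠ 0 := Complex.ofReal_ne_zero.mpr hT0.ne'
  set z : n → ℂ := (T : ℂ)⁻¹ • phaseAligned g p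
  have hKz : K *ᵥ z = g := funext fun l => by
    have hgl : g l = ((‖g l‖ : ℝ) : ℂ) * (g l / (‖g l‖ : ℂ)) :=
      (mul_div_cancel_of_imp' fun h => norm_eq_zero.mp (Complex.ofReal_eq_zero.mp h)).symm
    rw [Matrix.mulVec_diagonal, show z l = (T : ℂ)⁻¹ * phaseAligned g p l from rfl,
      phaseAligned, Complex.ofReal_mul, mul_comm (T : ℂ), mul_assoc, mul_inv_cancel_left₀ hT',
      ← mul_assoc, ← Complex.ofReal_mul, ← hg, ← hgl]
  have hz : matInner (outer z) K = 1 := by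
    rw [matInner_comm, matInner_outer_right, hKz, ← Complex.conj_re, ← RCLike.star_def,
      ← Matrix.star_dotProduct, dotProduct_smul, star_dotProduct_phaseAligned, smul_eq_mul,
      inv_mul_cancel₀ hT', Complex.one_re]
  simpa only [hKz] using posSemidef_sub_outer_mulVec hK hz

end Quadratic

lemma outer_kronecker {l n : Type*} (z : l → ℂ) (y : n → ℂ) :
    outer (fun p : l × n => z p.1 * y p.2) = outer z ⊗ₖ outer y := by
  ext p q
  simp only [outer, Matrix.vecMulVec_apply, Matrix.kroneckerMap_apply, Pi.star_apply, star_mul']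
  ring

section Kronecker

variable {l n : Type*} [Fintype l] [Fintype n]

lemma matInner_kronecker {A X : Matrix l l ℂ} (hA : A.IsHermitian) (hX : X.IsHermitian)
    (B Y : Matrix n n ℂ) : matInner (A ⊗ₖ B) (X ⊗ₖ Y) = matInner A X * matInner B Y := by
  have him : (Matrix.trace (A.conjTranspose * X)).im = 0 := by
    rw [← Complex.conj_eq_iff_im, ← RCLike.star_def, ← Matrix.trace_conjTranspose,
      Matrix.conjTranspose_mul, Matrix.conjTranspose_conjTranspose, hX.eq, Matrix.trace_mul_comm,
      hA.eq]
  rw [matInner, Matrix.conjTranspose_kronecker, ← Matrix.mul_kronecker_mul,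
    Matrix.trace_kronecker, Complex.mul_re, him, zero_mul, sub_zero]
  rfl

variable {W : Matrix (l × n) (l × n) ℂ}

lemma matInner_kronecker_le_left {A A' : Matrix l l ℂ} {B : Matrix n n ℂ}
    (hA : (A' - A).PosSemidef) (hB : B.PosSemidef) (hW : W.PosSemidef) :
    matInner (A ⊗ₖ B) W ≤ matInner (A' ⊗ₖ B) W := by
  have hsub : (A' - A) ⊗ₖ B = A' ⊗ₖ B - A ⊗ₖ B := by
    ext
    simp [sub_mul]
  exact matInner_le_matInner (hsub ▸ hA.kronecker hB) hW

lemma matInner_kronecker_le_right {A : Matrix l l ℂ} {B B' : Matrix n n ℂ}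
    (hA : A.PosSemidef) (hB : (B' - B).PosSemidef) (hW : W.PosSemidef) :
    matInner (A ⊗ₖ B) W ≤ matInner (A ⊗ₖ B') W := by
  have hsub : A ⊗ₖ (B' - B) = A ⊗ₖ B' - A ⊗ₖ B := by
    ext
    simp [mul_sub]
  exact matInner_le_matInner (hsub ▸ hA.kronecker hB) hW

end Kronecker

/-- The amplitudes `p` maximize `∑ hᵢ pᵢ` subject to `pᵢ² ≤ Pᵢ` and `∑ pᵢ² ≤ P₀`, as certified by
the multipliers `r`: the maximum of `∑ rᵢ qᵢ` over the powers `q` is attained at `qᵢ = pᵢ²`. -/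
structure IsWaterFilling {ι : Type*} [Fintype ι] (h : ι → ℝ) (P₀ : ℝ) (P p r : ι → ℝ) : Prop where
  sq_le : ∀ i, p i ^ 2 ≤ P i
  sum_sq_le : ∑ i, p i ^ 2 ≤ P₀
  multiplier_nonneg : ∀ i, 0 ≤ r i
  eq_mul : ∀ i, h i = r i * p i
  sum_mul_le : ∀ q : ι → ℝ, (∀ i, q i ≤ P i) → ∑ i, q i ≤ P₀ → ∑ i, r i * q i ≤ ∑ i, h i * p i

namespace IsWaterFilling

variable {ι : Type*} [Fintype ι] {h P : ι → ℝ} {P₀ : ℝ}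

lemma sum_mul_nonneg {p r : ι → ℝ} (H : IsWaterFilling h P₀ P p r) : 0 ≤ ∑ i, h i * p i :=
  Finset.sum_nonneg fun i _ => by
    rw [H.eq_mul, mul_assoc]
    exact mul_nonneg (H.multiplier_nonneg i) (mul_self_nonneg _)

lemma sqrt_of_sum_le (hh : ∀ i, 0 ≤ h i) (hP : ∀ i, 0 < P i) (hsum : ∑ i, P i ≤ P₀) :
    IsWaterFilling h P₀ P (fun i => √(P i)) (fun i => h i / √(P i)) where
  sq_le i := (Real.sq_sqrt (hP i).le).le
  sum_sq_le := by simpa only [Real.sq_sqrt (hP _).le] using hsum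
  multiplier_nonneg i := div_nonneg (hh i) (Real.sqrt_nonneg _)
  eq_mul i := (div_mul_cancel₀ _ (Real.sqrt_pos.mpr (hP i)).ne').symm
  sum_mul_le q hq _ := Finset.sum_le_sum fun i _ => by
    rw [show h i * √(P i) = h i / √(P i) * P i by rw [div_mul_comm, Real.div_sqrt, mul_comm]]
    exact mul_le_mul_of_nonneg_left (hq i) (div_nonneg (hh i) (Real.sqrt_nonneg _))

lemma proportional (hP : ∀ i, 0 ≤ P i) (hP₀ : 0 < P₀)
    (hprop : ∀ i, P₀ * h i ^ 2 ≤ P i * ∑ j, h j ^ 2) :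
    IsWaterFilling h P₀ P (fun i => √P₀ * h i / √(∑ j, h j ^ 2))
      (fun _ => √(∑ j, h j ^ 2) / √P₀) := by
  have hH : 0 ≤ ∑ j, h j ^ 2 := Finset.sum_nonneg fun j _ => sq_nonneg _
  have hsq : ∀ i, (√P₀ * h i / √(∑ j, h j ^ 2)) ^ 2 = P₀ * h i ^ 2 / ∑ j, h j ^ 2 := fun i => by
    rw [div_pow, mul_pow, Real.sq_sqrt hP₀.le, Real.sq_sqrt hH]
  have hmax : ∑ i, h i * (√P₀ * h i / √(∑ j, h j ^ 2)) = √(∑ j, h j ^ 2) / √P₀ * P₀ := by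
    calc ∑ i, h i * (√P₀ * h i / √(∑ j, h j ^ 2))
        = √P₀ * ((∑ j, h j ^ 2) / √(∑ j, h j ^ 2)) := by
          rw [Finset.sum_div, Finset.mul_sum]
          exact Finset.sum_congr rfl fun i _ => by ring
      _ = √(∑ j, h j ^ 2) / √P₀ * P₀ := by
          rw [Real.div_sqrt, div_mul_comm, Real.div_sqrt]
  refine ⟨fun i => ?_, ?_, fun _ => by positivity, fun i => ?_, fun q _ hq => ?_⟩
  · rw [hsq]
    exact div_le_of_le_mul₀ hH (hP i) (hprop i)
  · simp only [hsq]
    rw [← Finset.sum_div, ← Finset.mul_sum, mul_div_assoc]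
    exact mul_le_of_le_one_right hP₀.le (div_self_le_one _)
  · rcases hH.eq_or_lt with h0 | h0
    · have hi := (Finset.sum_eq_zero_iff_of_nonneg fun j _ => sq_nonneg (h j)).mp h0.symm i
        (Finset.mem_univ i)
      rw [← h0, Real.sqrt_zero, zero_div, zero_mul, pow_eq_zero_iff two_ne_zero |>.mp hi]
    · have := Real.sqrt_pos.mpr h0
      have := Real.sqrt_pos.mpr hP₀
      field_simp
  · rw [hmax, ← Finset.mul_sum]
    exact mul_le_mul_of_nonneg_left hq (by positivity)

end IsWaterFilling

lemma sum_fin_two_eq_add (f : Fin 2 → ℝ) (i : Fin 2) : ∑ j, f j = f i + f (i + 1) := by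
  fin_cases i
  · exact Fin.sum_univ_two f
  · exact (Fin.sum_univ_two f).trans (add_comm _ _)

lemma forall_fin_two_of_add_one {p : Fin 2 → Prop} (i : Fin 2) (hi : p i) (hi' : p (i + 1))
    (j : Fin 2) : p j := by
  fin_cases i <;> fin_cases j <;> assumption

lemma IsWaterFilling.of_saturated {h P p : Fin 2 → ℝ} {P₀ : ℝ} {i : Fin 2} (hh : ∀ j, 0 ≤ h j)
    (hP : 0 < P i) (hP₀ : P₀ ≤ ∑ j, P j) (hsat : P i * ∑ j, h j ^ 2 < P₀ * h i ^ 2)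
    (hp : p i = √(P i)) (hp' : p (i + 1) = √(P₀ - P i)) :
    IsWaterFilling h P₀ P p (fun j => h j / p j) := by
  rw [sum_fin_two_eq_add _ i] at hP₀ hsat
  have hP' : 0 < P₀ - P i := by
    by_contra! hcon
    nlinarith [sq_nonneg (h i), sq_nonneg (h (i + 1))]
  have hpos : 0 < p i := hp ▸ Real.sqrt_pos.mpr hP
  have hpos' : 0 < p (i + 1) := hp' ▸ Real.sqrt_pos.mpr hP'
  have hsq : p i ^ 2 = P i := by rw [hp, Real.sq_sqrt hP.le]
  have hsq' : p (i + 1) ^ 2 = P₀ - P i := by rw [hp', Real.sq_sqrt hP'.le]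
  have hp0 : ∀ j, 0 < p j := forall_fin_two_of_add_one i hpos hpos'
  have hslope : h (i + 1) / p (i + 1) ≤ h i / p i := by
    rw [div_le_div_iff₀ hpos' hpos]
    refine le_of_sq_le_sq ?_ (mul_nonneg (hh i) hpos'.le)
    rw [mul_pow, mul_pow, hsq, hsq']
    nlinarith
  refine ⟨forall_fin_two_of_add_one i hsq.le (by linarith), ?_,
    fun j => div_nonneg (hh j) (hp0 j).le, fun j => (div_mul_cancel₀ _ (hp0 j).ne').symm,
    fun q hq hq₀ => ?_⟩
  · rw [sum_fin_two_eq_add _ i, hsq, hsq', add_sub_cancel]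
  · have hmul : ∀ j, h j * p j = h j / p j * p j ^ 2 := fun j => by
      have := hp0 j
      field_simp
    have hr' : 0 ≤ h (i + 1) / p (i + 1) := div_nonneg (hh _) hpos'.le
    simp only [hmul]
    rw [sum_fin_two_eq_add _ i] at hq₀ ⊢
    rw [sum_fin_two_eq_add _ i, hsq, hsq']
    nlinarith [hq i]

/-- The optimal amplitude of antenna `i` of two, given the gains `h`, the total power `P₀` and the
antenna powers `P`: full power if the total power does not bind, power proportional to `h²` if that
is allowed, and otherwise one antenna saturates and the other one gets the rest. -/
noncomputable def waterLevel (h : Fin 2 → ℝ) (P₀ : ℝ) (P : Fin 2 → ℝ) (i : Fin 2) : ℝ :=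
  if P i + P (i + 1) ≤ P₀ then √(P i)
  else if P₀ * h i ^ 2 ≤ P i * (h i ^ 2 + h (i + 1) ^ 2) then
    if P₀ * h (i + 1) ^ 2 ≤ P (i + 1) * (h i ^ 2 + h (i + 1) ^ 2) then
      √P₀ * h i / √(h i ^ 2 + h (i + 1) ^ 2)
    else √(P₀ - P (i + 1))
  else √(P i)

lemma exists_isWaterFilling_waterLevel {h P : Fin 2 → ℝ} {P₀ : ℝ} (hh : ∀ i, 0 ≤ h i)
    (hP₀ : 0 < P₀) (hP : ∀ i, 0 < P i) : ∃ r, IsWaterFilling h P₀ P (waterLevel h P₀ P) r := by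
  have hlevel : ∀ i, waterLevel h P₀ P i =
      if ∑ j, P j ≤ P₀ then √(P i)
      else if P₀ * h i ^ 2 ≤ P i * ∑ j, h j ^ 2 then
        if P₀ * h (i + 1) ^ 2 ≤ P (i + 1) * ∑ j, h j ^ 2 then √P₀ * h i / √(∑ j, h j ^ 2)
        else √(P₀ - P (i + 1))
      else √(P i) := fun i => by
    rw [waterLevel, sum_fin_two_eq_add P i, sum_fin_two_eq_add (h · ^ 2) i]
  by_cases hsum : ∑ j, P j ≤ P₀
  · simp only [hsum, if_true] at hlevel
    rw [funext hlevel]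
    exact ⟨_, .sqrt_of_sum_le hh hP hsum⟩
  simp only [hsum, if_false] at hlevel
  by_cases hprop : ∀ i, P₀ * h i ^ 2 ≤ P i * ∑ j, h j ^ 2
  · simp only [hprop, if_true] at hlevel
    rw [funext hlevel]
    exact ⟨_, .proportional (fun i => (hP i).le) hP₀ hprop⟩
  · obtain ⟨i, hi⟩ := not_forall.mp hprop
    have hi' : P₀ * h (i + 1) ^ 2 ≤ P (i + 1) * ∑ j, h j ^ 2 := by
      rw [sum_fin_two_eq_add _ i] at hi hsum ⊢
      nlinarith [sq_nonneg (h i), sq_nonneg (h (i + 1))]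
    have hp' : waterLevel h P₀ P (i + 1) = √(P₀ - P i) := by
      rw [hlevel, if_pos hi', add_assoc, show (1 + 1 : Fin 2) = 0 from rfl, add_zero, if_neg hi]
    exact ⟨_, .of_saturated hh (hP i) (not_le.mp hsum).le (not_le.mp hi)
      (by rw [hlevel, if_neg hi]) hp'⟩

lemma div_add_one_le_div_add_one {a b a' b' κ : ℝ} (hb : 0 ≤ b) (hb' : 0 ≤ b') (hκ : 0 ≤ κ)
    (ha : a ≤ κ * (a + b)) (ha' : a' = κ * (a' + b')) (hab : 0 ≤ a' + b')
    (hle : a + b ≤ a' + b') : a / (b + 1) ≤ a' / (b' + 1) := by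
  rw [div_le_div_iff₀ (by linarith) (by linarith)]
  have h₁ : a * (a' + b' + 1) ≤ κ * (a + b) * (a' + b' + 1) :=
    mul_le_mul_of_nonneg_right ha (by linarith)
  have h₂ : κ * (a' + b') * (a + b + 1) = a' * (a + b + 1) := by rw [← ha']
  have h₃ : κ * (a + b) ≤ κ * (a' + b') := mul_le_mul_of_nonneg_left hle hκ
  linarith

namespace RelayNetwork

open scoped Matrix

variable {G : ℕ} {m : Fin G → ℕ} {L : ℕ} (S : RelayNetwork G m L)

lemma outer_chan (j : Fin G) (u : Σ k, Fin (m k)) :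
    outer (S.chan j u) = outer (star (S.f j)) ⊗ₖ outer (S.g u) :=
  outer_kronecker (star (S.f j)) (S.g u)

lemma A_add_C (u : Σ k, Fin (m k)) :
    S.A u + S.C u = ((1 / S.σU u ^ 2 : ℝ) : ℂ) • (S.rxCov ⊗ₖ outer (S.g u)) := by
  have hsum : S.A u + ∑ j ∈ Finset.univ.filter (fun j => j ≠ u.1),
        ((S.P j / S.σU u ^ 2 : ℝ) : ℂ) • outer (S.chan j u) =
      ∑ j, ((S.P j / S.σU u ^ 2 : ℝ) : ℂ) • outer (S.chan j u) := by
    rw [Finset.filter_ne']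
    exact Finset.add_sum_erase Finset.univ
      (fun j => ((S.P j / S.σU u ^ 2 : ℝ) : ℂ) • outer (S.chan j u)) (Finset.mem_univ u.1)
  rw [C, ← add_assoc, hsum, rxCov, Matrix.add_kronecker, smul_add]
  congr 1
  ext p q
  simp only [Matrix.smul_apply, Matrix.sum_apply, Matrix.kroneckerMap_apply, smul_eq_mul,
    Finset.sum_mul, Finset.mul_sum, outer_chan]
  refine Finset.sum_congr rfl fun j _ => ?_
  push_cast
  ring

lemma rxCov_kronecker_diagonal (d : Fin L → ℝ) :
    S.rxCov ⊗ₖ Matrix.diagonal (fun l => (d l : ℂ)) = ∑ l, (d l : ℂ) • S.D (some l) := by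
  ext p q
  simp only [D, Matrix.sum_apply, Matrix.kroneckerMap_apply, Matrix.smul_apply, smul_eq_mul,
    mul_left_comm _ (S.rxCov p.1 q.1), ← Finset.mul_sum]
  congr 1
  simp [Matrix.single_apply, Matrix.diagonal_apply, ite_and]

lemma D_none_eq_sum : S.D none = ∑ l, S.D (some l) := by
  simpa only [D, Pi.one_apply, Complex.ofReal_one, Matrix.diagonal_one, one_smul] using
    S.rxCov_kronecker_diagonal 1

lemma sinr_mono_of_le {u : Σ k, Fin (m k)} {W W' : Matrix (VecIdx L) (VecIdx L) ℂ} {κ : ℝ}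
    (hW : W.PosSemidef) (hW' : W'.PosSemidef) (hκ : 0 ≤ κ)
    (h : matInner (S.A u) W ≤ κ * matInner (S.A u + S.C u) W)
    (h' : matInner (S.A u) W' = κ * matInner (S.A u + S.C u) W')
    (hle : matInner (S.A u + S.C u) W ≤ matInner (S.A u + S.C u) W') :
    matInner (S.A u) W / (matInner (S.C u) W + 1) ≤
      matInner (S.A u) W' / (matInner (S.C u) W' + 1) := by
  rw [matInner_add_left] at h h' hle
  rw [matInner_add_left] at hle
  exact div_add_one_le_div_add_one (matInner_nonneg (S.posSemidef_C u) hW)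
    (matInner_nonneg (S.posSemidef_C u) hW') hκ h h'
    (add_nonneg (matInner_nonneg (S.posSemidef_A u) hW')
      (matInner_nonneg (S.posSemidef_C u) hW')) hle

lemma matInner_A_add_C_le {W : Matrix (VecIdx L) (VecIdx L) ℂ} (hW : W ∈ S.sdrFeasible)
    {u : Σ k, Fin (m k)} {p r : Fin L → ℝ}
    (hp : IsWaterFilling (‖S.g u ·‖) (S.Pbar none) (fun l => S.Pbar (some l)) p r) :
    matInner (S.A u + S.C u) W ≤ 1 / S.σU u ^ 2 * (∑ l, ‖S.g u l‖ * p l) ^ 2 := by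
  have hpow : ∑ l, matInner (S.D (some l)) W ≤ S.Pbar none := by
    rw [← matInner_sum_left, ← D_none_eq_sum]
    exact hW.2 none
  rw [A_add_C, matInner_smul_left]
  refine mul_le_mul_of_nonneg_left ?_ (one_div_nonneg.mpr (sq_nonneg _))
  calc matInner (S.rxCov ⊗ₖ outer (S.g u)) W
      ≤ matInner (S.rxCov ⊗ₖ Matrix.diagonal
          fun l => (((∑ i, ‖S.g u i‖ * p i) * r l : ℝ) : ℂ)) W :=
        matInner_kronecker_le_right S.posDef_rxCov.posSemidef
          (posSemidef_diagonal_sub_outer hp.multiplier_nonneg hp.eq_mul) hW.1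
    _ = (∑ i, ‖S.g u i‖ * p i) * ∑ l, r l * matInner (S.D (some l)) W := by
        simp only [rxCov_kronecker_diagonal, matInner_sum_left, matInner_smul_left, mul_assoc,
          Finset.mul_sum]
    _ ≤ (∑ l, ‖S.g u l‖ * p l) ^ 2 := by
        rw [pow_two]
        exact mul_le_mul_of_nonneg_left (hp.sum_mul_le _ (fun l => hW.2 (some l)) hpow)
          hp.sum_mul_nonneg

lemma sq_mul_matInner_A_le {W : Matrix (VecIdx L) (VecIdx L) ℂ} (hW : W.PosSemidef)
    {u : Σ k, Fin (m k)} {z : Fin L → ℂ} (hz : matInner (outer z) S.rxCov = 1) {s : ℝ}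
    (hKz : S.rxCov *ᵥ z = (s : ℂ) • star (S.f u.1)) :
    s ^ 2 * matInner (S.A u) W ≤ S.P u.1 * matInner (S.A u + S.C u) W := by
  have hle := matInner_kronecker_le_left
    (posSemidef_sub_outer_mulVec S.posDef_rxCov.posSemidef hz) (posSemidef_outer (S.g u)) hW
  rw [hKz, outer_smul, Complex.normSq_ofReal, ← pow_two, Matrix.smul_kronecker,
    matInner_smul_left] at hle
  rw [A_add_C, A, outer_chan, matInner_smul_left, matInner_smul_left]
  calc s ^ 2 * (S.P u.1 / S.σU u ^ 2 * matInner (outer (star (S.f u.1)) ⊗ₖ outer (S.g u)) W)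
      = S.P u.1 / S.σU u ^ 2 *
          (s ^ 2 * matInner (outer (star (S.f u.1)) ⊗ₖ outer (S.g u)) W) := by ring
    _ ≤ S.P u.1 / S.σU u ^ 2 * matInner (S.rxCov ⊗ₖ outer (S.g u)) W :=
        mul_le_mul_of_nonneg_left hle (div_nonneg (S.P_nonneg _) (sq_nonneg _))
    _ = S.P u.1 * (1 / S.σU u ^ 2 * matInner (S.rxCov ⊗ₖ outer (S.g u)) W) := by ring

/-- The relay beamformer `vec V` for a matrix `V = y zᵀ` of rank one: the received signals are
combined with the weights `z` and sent with the amplitudes `p`, in phase at user `u`. -/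
noncomputable def matchedBeam (u : Σ k, Fin (m k)) (p : Fin L → ℝ) (z : Fin L → ℂ) :
    VecIdx L → ℂ :=
  fun i => z i.1 * phaseAligned (S.g u) p i.2

lemma outer_matchedBeam (u : Σ k, Fin (m k)) (p : Fin L → ℝ) (z : Fin L → ℂ) :
    outer (S.matchedBeam u p z) = outer z ⊗ₖ outer (phaseAligned (S.g u) p) :=
  outer_kronecker z (phaseAligned (S.g u) p)

lemma matInner_kronecker_matchedBeam {X : Matrix (Fin L) (Fin L) ℂ} (hX : X.IsHermitian)
    (u : Σ k, Fin (m k)) (p : Fin L → ℝ) (z : Fin L → ℂ) :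
    matInner (X ⊗ₖ outer (S.g u)) (outer (S.matchedBeam u p z)) =
      matInner (outer z) X * (∑ l, ‖S.g u l‖ * p l) ^ 2 := by
  rw [outer_matchedBeam, matInner_kronecker hX (isHermitian_outer z),
    matInner_comm X, matInner_outer_outer, star_dotProduct_phaseAligned, Complex.normSq_ofReal,
    ← pow_two]

lemma matInner_A_add_C_matchedBeam (u : Σ k, Fin (m k)) (p : Fin L → ℝ) {z : Fin L → ℂ}
    (hz : matInner (outer z) S.rxCov = 1) :
    matInner (S.A u + S.C u) (outer (S.matchedBeam u p z)) =
      1 / S.σU u ^ 2 * (∑ l, ‖S.g u l‖ * p l) ^ 2 := by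
  rw [A_add_C, matInner_smul_left, S.matInner_kronecker_matchedBeam S.posDef_rxCov.isHermitian,
    hz, one_mul]

lemma sq_mul_matInner_A_matchedBeam (u : Σ k, Fin (m k)) (p : Fin L → ℝ) {z : Fin L → ℂ}
    (hz : matInner (outer z) S.rxCov = 1) {s : ℝ}
    (hKz : S.rxCov *ᵥ z = (s : ℂ) • star (S.f u.1)) :
    s ^ 2 * matInner (S.A u) (outer (S.matchedBeam u p z)) =
      S.P u.1 * matInner (S.A u + S.C u) (outer (S.matchedBeam u p z)) := by
  have hfz : s ^ 2 * matInner (outer z) (outer (star (S.f u.1))) = 1 := by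
    rw [← matInner_smul_right, pow_two, ← Complex.normSq_ofReal, ← outer_smul, ← hKz,
      matInner_outer_outer, star_dotProduct_mulVec_self S.posDef_rxCov.isHermitian, hz,
      Complex.ofReal_one, Complex.normSq_one]
  rw [S.matInner_A_add_C_matchedBeam u p hz, A, outer_chan, matInner_smul_left,
    S.matInner_kronecker_matchedBeam (isHermitian_outer _)]
  linear_combination S.P u.1 / S.σU u ^ 2 * (∑ l, ‖S.g u l‖ * p l) ^ 2 * hfz

lemma matInner_D_matchedBeam_le (u : Σ k, Fin (m k)) (p : Fin L → ℝ) {z : Fin L → ℂ}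
    (hz : matInner (outer z) S.rxCov ≤ 1) (l : Fin L) :
    matInner (S.D (some l)) (outer (S.matchedBeam u p z)) ≤ p l ^ 2 := by
  set y := phaseAligned (S.g u) p
  have hsingle : matInner (Matrix.single l l (1 : ℂ)) (outer y) = Complex.normSq (y l) := by
    have hmul : Matrix.single l l (1 : ℂ) *ᵥ y = Pi.single l (y l) := by
      rw [Matrix.single_mulVec, one_mul]
      rfl
    rw [matInner_outer_right, hmul, dotProduct_single, Pi.star_apply, RCLike.star_def,
      ← Complex.normSq_eq_conj_mul_self, Complex.ofReal_re]
  rw [outer_matchedBeam, D, matInner_kronecker S.posDef_rxCov.isHermitian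
    (isHermitian_outer z), matInner_comm, hsingle]
  exact (mul_le_of_le_one_left (Complex.normSq_nonneg _) hz).trans (normSq_phaseAligned_le _ _ l)

lemma outer_matchedBeam_mem_sdrFeasible {u : Σ k, Fin (m k)} {p r : Fin L → ℝ}
    (hp : IsWaterFilling (‖S.g u ·‖) (S.Pbar none) (fun l => S.Pbar (some l)) p r)
    {z : Fin L → ℂ} (hz : matInner (outer z) S.rxCov ≤ 1) :
    outer (S.matchedBeam u p z) ∈ S.sdrFeasible := by
  have hD := S.matInner_D_matchedBeam_le u p hz
  refine ⟨posSemidef_outer _, fun l => ?_⟩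
  cases l with
  | some l => exact (hD l).trans (hp.sq_le l)
  | none =>
    rw [D_none_eq_sum, matInner_sum_left]
    exact (Finset.sum_le_sum fun l _ => hD l).trans hp.sum_sq_le

lemma isSDROptimal_outer_matchedBeam [Unique (Σ k, Fin (m k))] {p r : Fin L → ℝ}
    (hp : IsWaterFilling (‖S.g default ·‖) (S.Pbar none) (fun l => S.Pbar (some l)) p r)
    {z : Fin L → ℂ} (hz : matInner (outer z) S.rxCov = 1) {s : ℝ} (hs : s ≠ 0)
    (hKz : S.rxCov *ᵥ z = (s : ℂ) • star (S.f (default : Σ k, Fin (m k)).1)) :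
    S.IsSDROptimal (outer (S.matchedBeam default p z)) := by
  refine ⟨S.outer_matchedBeam_mem_sdrFeasible hp hz.le, fun W hW => ?_⟩
  have hs2 : 0 < s ^ 2 := by positivity
  rw [gam, gam, ciInf_unique, ciInf_unique]
  refine S.sinr_mono_of_le (κ := S.P (default : Σ k, Fin (m k)).1 / s ^ 2) hW.1
    (posSemidef_outer _) (div_nonneg (S.P_nonneg _) hs2.le) ?_ ?_ ?_
  · rw [div_mul_eq_mul_div, le_div_iff₀' hs2]
    exact S.sq_mul_matInner_A_le hW.1 hz hKz
  · rw [div_mul_eq_mul_div, eq_div_iff hs2.ne', mul_comm]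
    exact S.sq_mul_matInner_A_matchedBeam _ p hz hKz
  · rw [S.matInner_A_add_C_matchedBeam _ p hz]
    exact S.matInner_A_add_C_le hW hp

lemma isSDROptimal_of_f_eq_zero [Unique (Σ k, Fin (m k))]
    (hf : S.f (default : Σ k, Fin (m k)).1 = 0) {W : Matrix (VecIdx L) (VecIdx L) ℂ}
    (hW : W ∈ S.sdrFeasible) : S.IsSDROptimal W := by
  have hgam : ∀ W', S.gam W' = 0 := fun W' => by
    rw [gam, ciInf_unique, A, outer_chan, hf, star_zero]
    simp [outer, matInner]
  exact ⟨hW, fun W' _ => by rw [hgam, hgam]⟩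

/-- The vector `adj(K) f^*` for the received covariance `K`: the direction of the weights with the
best signal to noise ratio, computed without division. -/
noncomputable def matchedDir (u : Σ k, Fin (m k)) : Fin L → ℂ :=
  S.rxCov.adjugate *ᵥ star (S.f u.1)

/-- The squared norm `zᴴ K z` of `z = adj(K) f^*`. -/
noncomputable def matchedNormSq (u : Σ k, Fin (m k)) : ℝ :=
  matInner (outer (S.matchedDir u)) S.rxCov

/-- The vector `adj(K) f^*`, normalized in the norm of `K`; it is `0` if `f = 0`. -/
noncomputable def matchedUnit (u : Σ k, Fin (m k)) : Fin L → ℂ :=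
  ((√(S.matchedNormSq u))⁻¹ : ℝ) • S.matchedDir u

lemma rxCov_mulVec_matchedDir (u : Σ k, Fin (m k)) :
    S.rxCov *ᵥ S.matchedDir u = S.rxCov.det • star (S.f u.1) := by
  rw [matchedDir, Matrix.mulVec_mulVec, Matrix.mul_adjugate, Matrix.smul_mulVec, Matrix.one_mulVec]

lemma matInner_outer_matchedUnit (u : Σ k, Fin (m k)) :
    matInner (outer (S.matchedUnit u)) S.rxCov = S.matchedNormSq u / S.matchedNormSq u := by
  have hn : 0 ≤ S.matchedNormSq u := matInner_nonneg (posSemidef_outer _) S.posDef_rxCov.posSemidef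
  rw [matchedUnit, ← Complex.coe_smul, outer_smul, matInner_smul_left, Complex.normSq_ofReal,
    ← mul_inv, Real.mul_self_sqrt hn, ← matchedNormSq, inv_mul_eq_div]

lemma matchedNormSq_pos {u : Σ k, Fin (m k)} (hf : S.f u.1 ≠ 0) : 0 < S.matchedNormSq u := by
  have hdir : S.matchedDir u ≠ 0 := fun h0 => by
    have h := S.rxCov_mulVec_matchedDir u
    rw [h0, Matrix.mulVec_zero, eq_comm, smul_eq_zero] at h
    exact h.elim S.posDef_rxCov.det_pos.ne' fun h => hf (star_eq_zero.mp h)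
  rw [matchedNormSq, matInner_outer_left]
  exact (Complex.lt_def.mp (S.posDef_rxCov.dotProduct_mulVec_pos hdir)).1

lemma rxCov_mulVec_matchedUnit (u : Σ k, Fin (m k)) :
    S.rxCov *ᵥ S.matchedUnit u =
      (((√(S.matchedNormSq u))⁻¹ * S.rxCov.det.re : ℝ) : ℂ) • star (S.f u.1) := by
  have hdet : S.rxCov.det = (S.rxCov.det.re : ℂ) :=
    Complex.ext rfl (Complex.lt_def.mp S.posDef_rxCov.det_pos).2.symm
  rw [matchedUnit, Matrix.mulVec_smul, rxCov_mulVec_matchedDir, ← Complex.coe_smul, smul_smul,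
    Complex.ofReal_mul, ← hdet]

lemma isSDROptimal_outer_matchedBeam_matchedUnit [Unique (Σ k, Fin (m k))] {p r : Fin L → ℝ}
    (hp : IsWaterFilling (‖S.g default ·‖) (S.Pbar none) (fun l => S.Pbar (some l)) p r) :
    S.IsSDROptimal (outer (S.matchedBeam default p (S.matchedUnit default))) := by
  have hz := S.matInner_outer_matchedUnit default
  by_cases hf : S.f (default : Σ k, Fin (m k)).1 = 0
  · exact S.isSDROptimal_of_f_eq_zero hf
      (S.outer_matchedBeam_mem_sdrFeasible hp (hz.trans_le (div_self_le_one _)))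
  · have hn := S.matchedNormSq_pos hf
    have hdet := (Complex.lt_def.mp S.posDef_rxCov.det_pos).1
    exact S.isSDROptimal_outer_matchedBeam hp (hz.trans (div_self hn.ne'))
      (mul_pos (inv_pos.mpr (Real.sqrt_pos.mpr hn)) hdet).ne' (S.rxCov_mulVec_matchedUnit default)

end RelayNetwork

/-- An optimal beamformer for a relay with two antennas and the single user `u`. -/
noncomputable def RelayNetwork.optVec {G : ℕ} {m : Fin G → ℕ} (S : RelayNetwork G m 2)
    (u : Σ k, Fin (m k)) : VecIdx 2 → ℂ :=
  S.matchedBeam u (waterLevel (‖S.g u ·‖) (S.Pbar none) fun l => S.Pbar (some l)) (S.matchedUnit u)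

lemma RelayNetwork.isSDROptimal_outer_optVec {G : ℕ} {m : Fin G → ℕ} [Unique (Σ k, Fin (m k))]
    (S : RelayNetwork G m 2) : S.IsSDROptimal (outer (S.optVec default)) := by
  obtain ⟨r, hr⟩ := exists_isWaterFilling_waterLevel (fun l => norm_nonneg (S.g default l))
    (S.Pbar_pos none) fun l => S.Pbar_pos (some l)
  exact S.isSDROptimal_outer_matchedBeam_matchedUnit hr

lemma RealProgram.exists_cost_le_eval_eq_sum {ι : Type} (c : ℕ) :
    ∀ (n : ℕ) (p : Fin n → RealProgram ι), (∀ j, (p j).cost ≤ c) →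
      ∃ q : RealProgram ι, q.cost ≤ n * (c + 1) + 1 ∧ ∀ x, q.eval x = ∑ j, (p j).eval x
  | 0, _, _ => ⟨.const 0, by simp [cost], fun x => by simp [eval]⟩
  | n + 1, p, hp => by
    obtain ⟨q, hq, hqe⟩ := exists_cost_le_eval_eq_sum c n (fun j => p j.succ) fun j => hp _
    refine ⟨.add (p 0) q, ?_, fun x => ?_⟩
    · have := hp 0
      simp only [cost]
      nlinarith
    · rw [Fin.sum_univ_succ, ← hqe]
      rfl

/-- A quantity with values in `α` attached to every relay network with `L` antennas and a marked
user. -/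
abbrev NetworkQuantity (L : ℕ) (α : Type) : Type :=
  ∀ (G : ℕ) (m : Fin G → ℕ), (Σ k, Fin (m k)) → RelayNetwork G m L → α

/-- A real quantity is linearly computable if it is the value of a program of size linear in the
number of transmitters, uniformly in the dimensions. The program may depend on the marked user. -/
def LinComputable {L : ℕ} (F : NetworkQuantity L ℝ) : Prop :=
  ∃ c : ℕ, ∀ (G : ℕ) (m : Fin G → ℕ) (u : Σ k, Fin (m k)),
    ∃ p : RealProgram (NetworkInput G m L), p.cost ≤ c * (G + 1) ∧
      ∀ S : RelayNetwork G m L, p.eval S.encode = F G m u S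

namespace LinComputable

variable {L : ℕ} {F H I J : NetworkQuantity L ℝ}

lemma input (i : ∀ (G : ℕ) (m : Fin G → ℕ), (Σ k, Fin (m k)) → NetworkInput G m L) :
    LinComputable fun G m u S => S.encode (i G m u) :=
  ⟨1, fun G m u => ⟨.input (i G m u), by simp [RealProgram.cost], fun _ => rfl⟩⟩

lemma const (q : ℚ) : LinComputable (L := L) fun _ _ _ _ => (q : ℝ) :=
  ⟨1, fun G m u => ⟨.const q, by simp [RealProgram.cost], fun _ => rfl⟩⟩

lemma binary (hF : LinComputable F) (hH : LinComputable H) {f : ℝ → ℝ → ℝ}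
    (op : ∀ {ι : Type}, RealProgram ι → RealProgram ι → RealProgram ι)
    (hcost : ∀ {ι : Type} (p q : RealProgram ι), (op p q).cost = p.cost + q.cost + 1)
    (heval : ∀ {ι : Type} (p q : RealProgram ι) (x : ι → ℝ),
      (op p q).eval x = f (p.eval x) (q.eval x)) :
    LinComputable fun G m u S => f (F G m u S) (H G m u S) := by
  obtain ⟨c, hc⟩ := hF
  obtain ⟨d, hd⟩ := hH
  refine ⟨c + d + 1, fun G m u => ?_⟩
  obtain ⟨p, hp, hpe⟩ := hc G m u
  obtain ⟨q, hq, hqe⟩ := hd G m u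
  exact ⟨op p q, by rw [hcost]; linarith, fun S => by rw [heval, hpe, hqe]⟩

lemma add (hF : LinComputable F) (hH : LinComputable H) :
    LinComputable fun G m u S => F G m u S + H G m u S :=
  hF.binary hH .add (fun _ _ => rfl) fun _ _ _ => rfl

lemma sub (hF : LinComputable F) (hH : LinComputable H) :
    LinComputable fun G m u S => F G m u S - H G m u S :=
  hF.binary hH .sub (fun _ _ => rfl) fun _ _ _ => rfl

lemma mul (hF : LinComputable F) (hH : LinComputable H) :
    LinComputable fun G m u S => F G m u S * H G m u S :=
  hF.binary hH .mul (fun _ _ => rfl) fun _ _ _ => rfl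

lemma div (hF : LinComputable F) (hH : LinComputable H) :
    LinComputable fun G m u S => F G m u S / H G m u S :=
  hF.binary hH .div (fun _ _ => rfl) fun _ _ _ => rfl

lemma sq (hF : LinComputable F) : LinComputable fun G m u S => F G m u S ^ 2 := by
  simpa only [pow_two] using hF.mul hF

lemma inv (hF : LinComputable F) : LinComputable fun G m u S => (F G m u S)⁻¹ := by
  simpa only [Rat.cast_one, one_div] using (const 1).div hF

lemma sqrt (hF : LinComputable F) : LinComputable fun G m u S => √(F G m u S) := by
  obtain ⟨c, hc⟩ := hF
  refine ⟨c + 1, fun G m u => ?_⟩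
  obtain ⟨p, hp, hpe⟩ := hc G m u
  exact ⟨.sqrt p, by rw [RealProgram.cost]; linarith, fun S => by rw [RealProgram.eval, hpe]⟩

lemma ite_le (hF : LinComputable F) (hH : LinComputable H) (hI : LinComputable I)
    (hJ : LinComputable J) : LinComputable fun G m u S =>
      if F G m u S ≤ H G m u S then I G m u S else J G m u S := by
  obtain ⟨b, hb⟩ := hH.sub hF
  obtain ⟨c, hc⟩ := hI
  obtain ⟨d, hd⟩ := hJ
  refine ⟨b + c + d + 1, fun G m u => ?_⟩
  obtain ⟨r, hr, hre⟩ := hb G m u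
  obtain ⟨p, hp, hpe⟩ := hc G m u
  obtain ⟨q, hq, hqe⟩ := hd G m u
  exact ⟨.ifNonneg r p q, by rw [RealProgram.cost]; linarith,
    fun S => by simp only [RealProgram.eval, hre, hpe, hqe, sub_nonneg]⟩

lemma sum_transmitters {p : ∀ (G : ℕ) (m : Fin G → ℕ), Fin G → RealProgram (NetworkInput G m L)}
    {c : ℕ} (hp : ∀ G m j, (p G m j).cost ≤ c) :
    LinComputable fun G m _ S => ∑ j, (p G m j).eval S.encode := by
  refine ⟨c + 1, fun G m _ => ?_⟩
  obtain ⟨q, hq, hqe⟩ := RealProgram.exists_cost_le_eval_eq_sum c G (p G m) (hp G m)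
  exact ⟨q, by linarith, fun S => hqe _⟩

end LinComputable

/-- A complex quantity is linearly computable if its real and imaginary parts are. -/
def CLinComputable {L : ℕ} (F : NetworkQuantity L ℂ) : Prop :=
  LinComputable (fun G m u S => (F G m u S).re) ∧ LinComputable (fun G m u S => (F G m u S).im)

namespace CLinComputable

variable {L : ℕ} {F H : NetworkQuantity L ℂ} {R : NetworkQuantity L ℝ}

lemma add (hF : CLinComputable F) (hH : CLinComputable H) :
    CLinComputable fun G m u S => F G m u S + H G m u S :=
  ⟨hF.1.add hH.1, hF.2.add hH.2⟩

lemma mul (hF : CLinComputable F) (hH : CLinComputable H) :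
    CLinComputable fun G m u S => F G m u S * H G m u S :=
  ⟨(hF.1.mul hH.1).sub (hF.2.mul hH.2), (hF.1.mul hH.2).add (hF.2.mul hH.1)⟩

lemma ofReal (hR : LinComputable R) : CLinComputable fun G m u S => (R G m u S : ℂ) := by
  refine ⟨hR, ?_⟩
  simpa only [Complex.ofReal_im, Rat.cast_zero] using LinComputable.const 0

lemma neg (hF : CLinComputable F) : CLinComputable fun G m u S => -F G m u S := by
  simpa using (ofReal (.const (-1))).mul hF

lemma star (hF : CLinComputable F) : CLinComputable fun G m u S => conj (F G m u S) := by
  refine ⟨hF.1, ?_⟩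
  simpa only [Rat.cast_zero, zero_sub, Complex.conj_im] using (LinComputable.const 0).sub hF.2

lemma smul (hR : LinComputable R) (hF : CLinComputable F) :
    CLinComputable fun G m u S => R G m u S • F G m u S := by
  simpa only [Complex.real_smul] using (ofReal hR).mul hF

lemma div_ofReal (hF : CLinComputable F) (hR : LinComputable R) :
    CLinComputable fun G m u S => F G m u S / (R G m u S : ℂ) := by
  refine ⟨?_, ?_⟩
  · simpa only [Complex.div_ofReal_re] using hF.1.div hR
  · simpa only [Complex.div_ofReal_im] using hF.2.div hR

lemma norm (hF : CLinComputable F) : LinComputable fun G m u S => ‖F G m u S‖ := by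
  simpa only [Complex.norm_def, Complex.normSq_apply] using
    ((hF.1.mul hF.1).add (hF.2.mul hF.2)).sqrt

lemma sum {ι : Type*} (s : Finset ι) {F : ι → NetworkQuantity L ℂ}
    (hF : ∀ i, CLinComputable (F i)) : CLinComputable fun G m u S => ∑ i ∈ s, F i G m u S := by
  classical
  induction s using Finset.induction_on with
  | empty => simpa using ofReal (L := L) (.const 0)
  | insert i s hi ih => simpa only [Finset.sum_insert hi] using (hF i).add ih

end CLinComputable

section Quantities

open RelayNetwork

open scoped Matrix

variable {L : ℕ}

lemma CLinComputable.mulVec {n : ℕ} {A : NetworkQuantity L (Matrix (Fin n) (Fin n) ℂ)}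
    {v : NetworkQuantity L (Fin n → ℂ)} (hA : ∀ i j, CLinComputable fun G m u S => A G m u S i j)
    (hv : ∀ i, CLinComputable fun G m u S => v G m u S i) (i : Fin n) :
    CLinComputable fun G m u S => (A G m u S *ᵥ v G m u S) i :=
  .sum _ fun j => (hA i j).mul (hv j)

lemma clinComputable_f (l : Fin L) : CLinComputable fun _ _ u S => S.f u.1 l :=
  ⟨.input fun _ _ u => .fRe u.1 l, .input fun _ _ u => .fIm u.1 l⟩

lemma clinComputable_g (l : Fin L) : CLinComputable fun _ _ u S => S.g u l :=
  ⟨.input fun _ _ u => .gRe u l, .input fun _ _ u => .gIm u l⟩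

lemma clinComputable_noiseCov (c d : Fin L) : CLinComputable fun _ _ _ S => S.noiseCov c d := by
  by_cases h : c = d
  · subst h
    simpa only [noiseCov, Matrix.diagonal_apply_eq, encode] using
      CLinComputable.ofReal (LinComputable.input fun _ _ _ => .sigmaR c).sq
  · simpa [noiseCov, h] using CLinComputable.ofReal (L := L) (.const 0)

lemma clinComputable_rxCov (c d : Fin L) : CLinComputable fun _ _ _ S => S.rxCov c d := by
  have hsignal : CLinComputable (L := L)
      fun _ _ _ S => ∑ j, (S.P j : ℂ) * (conj (S.f j c) * S.f j d) := by
    constructor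
    · convert LinComputable.sum_transmitters (c := 9) (p := fun G m j =>
        .mul (.input (.power j)) (.add (.mul (.input (.fRe j c)) (.input (.fRe j d)))
          (.mul (.input (.fIm j c)) (.input (.fIm j d))))) fun G m j => le_rfl using 5
      simp [RealProgram.eval, encode]
    · convert LinComputable.sum_transmitters (c := 9) (p := fun G m j =>
        .mul (.input (.power j)) (.sub (.mul (.input (.fRe j c)) (.input (.fIm j d)))
          (.mul (.input (.fIm j c)) (.input (.fRe j d))))) fun G m j => le_rfl using 5
      simp [RealProgram.eval, encode, sub_eq_add_neg]
  simpa only [rxCov, outer, Matrix.add_apply, Matrix.sum_apply, Matrix.smul_apply,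
    Matrix.vecMulVec_apply, Pi.star_apply, star_star, smul_eq_mul, RCLike.star_def] using
    hsignal.add (clinComputable_noiseCov c d)

lemma clinComputable_matchedDir (l : Fin 2) :
    CLinComputable fun _ _ u S => S.matchedDir u l := by
  refine .mulVec (A := fun _ _ _ S => S.rxCov.adjugate) (fun i j => ?_)
    (fun i => (clinComputable_f i).star) l
  simp only [Matrix.adjugate_fin_two]
  fin_cases i <;> fin_cases j
  · exact clinComputable_rxCov 1 1
  · exact (clinComputable_rxCov 0 1).neg
  · exact (clinComputable_rxCov 1 0).neg
  · exact clinComputable_rxCov 0 0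

lemma linComputable_matchedNormSq :
    LinComputable (L := 2) fun _ _ u S => S.matchedNormSq u := by
  have h : CLinComputable (L := 2)
      fun _ _ u S => star (S.matchedDir u) ⬝ᵥ S.rxCov *ᵥ S.matchedDir u :=
    .sum _ fun i => (clinComputable_matchedDir i).star.mul
      (.mulVec clinComputable_rxCov clinComputable_matchedDir i)
  simpa only [matchedNormSq, matInner_outer_left] using h.1

lemma LinComputable.waterLevel {h P : Fin 2 → NetworkQuantity L ℝ} {P₀ : NetworkQuantity L ℝ}
    (hh : ∀ i, LinComputable (h i)) (hP₀ : LinComputable P₀) (hP : ∀ i, LinComputable (P i))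
    (i : Fin 2) : LinComputable fun G m u S =>
      _root_.waterLevel (fun j => h j G m u S) (P₀ G m u S) (fun j => P j G m u S) i := by
  have hH := (hh i).sq.add (hh (i + 1)).sq
  exact .ite_le ((hP i).add (hP (i + 1))) hP₀ (hP i).sqrt
    (.ite_le (hP₀.mul (hh i).sq) ((hP i).mul hH)
      (.ite_le (hP₀.mul (hh (i + 1)).sq) ((hP (i + 1)).mul hH)
        ((hP₀.sqrt.mul (hh i)).div hH.sqrt) (hP₀.sub (hP (i + 1))).sqrt)
      (hP i).sqrt)

lemma clinComputable_optVec (i : VecIdx 2) : CLinComputable fun _ _ u S => S.optVec u i := by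
  have hlevel : LinComputable fun _ _ u S =>
      waterLevel (‖S.g u ·‖) (S.Pbar none) (fun l => S.Pbar (some l)) i.2 :=
    .waterLevel (fun l => (clinComputable_g l).norm) (.input fun _ _ _ => .bound none)
      (fun l => .input fun _ _ _ => .bound (some l)) i.2
  have hunit : CLinComputable fun _ _ u S => S.matchedUnit u i.1 :=
    .smul linComputable_matchedNormSq.sqrt.inv (clinComputable_matchedDir i.1)
  exact hunit.mul ((CLinComputable.ofReal hlevel).mul
    ((clinComputable_g i.2).div_ofReal (clinComputable_g i.2).norm))

end Quantities

lemma exists_matrixSolver_of_clinComputable {L : ℕ}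
    {F : NetworkQuantity L (Matrix (VecIdx L) (VecIdx L) ℂ)}
    (hF : ∀ i j, CLinComputable fun G m u S => F G m u S i j) :
    ∃ c : ℕ, ∀ (G : ℕ) (m : Fin G → ℕ) (u : Σ k, Fin (m k)),
      ∃ alg : MatrixSolver G m L, alg.cost ≤ c * (G + 1) ∧ ∀ S, alg.run S = F G m u S := by
  choose a ha using fun i j => (hF i j).1
  choose b hb using fun i j => (hF i j).2
  refine ⟨∑ i, ∑ j, (a i j + b i j), fun G m u => ?_⟩
  choose p hp hpe using fun i j => ha i j G m u
  choose q hq hqe using fun i j => hb i j G m u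
  refine ⟨⟨p, q⟩, ?_, fun S => ?_⟩
  · simp only [MatrixSolver.cost, Finset.sum_mul, add_mul]
    exact Finset.sum_le_sum fun i _ => Finset.sum_le_sum fun j _ => add_le_add (hp i j) (hq i j)
  · ext i j
    exact Complex.ext (hpe i j S) (hqe i j S)

lemma exists_optimal_rankOne_matrixSolver :
    ∃ c : ℕ, ∀ (G : ℕ) (m : Fin G → ℕ), ∑ k, m k = 1 →
      ∃ alg : MatrixSolver G m 2, alg.cost ≤ c * (G + 1) ∧
        ∀ S : RelayNetwork G m 2, S.IsSDROptimal (alg.run S) ∧ (alg.run S).rank ≤ 1 := by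
  obtain ⟨c, hc⟩ := exists_matrixSolver_of_clinComputable
    (F := fun _ _ u S => outer (S.optVec u))
    fun i j => (clinComputable_optVec i).mul (clinComputable_optVec j).star
  refine ⟨c, fun G m hm => ?_⟩
  have hcard : Fintype.card (Σ k, Fin (m k)) = 1 := by simpa using hm
  obtain ⟨hunique⟩ := Fintype.card_eq_one_iff_nonempty_unique.mp hcard
  obtain ⟨alg, hcost, hrun⟩ := hc G m default
  exact ⟨alg, hcost, fun S => (hrun S).symm ▸ ⟨S.isSDROptimal_outer_optVec, rank_outer_le_one _⟩⟩

theorem theorem1_general :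
    (∃ c : ℕ, ∀ (G : ℕ) (m : Fin G → ℕ) (L : ℕ), 2 ≤ L → 1 ≤ ∑ k, m k → (∑ k, m k) + L ≤ 3 →
      ∃ alg : MatrixSolver G m L, alg.cost ≤ c * (G + (∑ k, m k) + L) ^ c ∧
        ∀ S : RelayNetwork G m L, S.IsSDROptimal (alg.run S) ∧ (alg.run S).rank ≤ 1) ∧
    (∀ (G : ℕ) (m : Fin G → ℕ) (L : ℕ) (S : RelayNetwork G m L)
      (W : Matrix (VecIdx L) (VecIdx L) ℂ), W.PosSemidef →
      ∀ (N : ℕ), 1 ≤ N → ∀ ξ : Fin N → VecIdx L → ℂ,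
        (∃ w, S.IsOutput W ξ w) ∧
        (W.rank ≤ 1 → ∀ w, S.IsOutput W ξ w → S.rate (outer w) = S.rate W)) ∧
    (∀ (G : ℕ) (m : Fin G → ℕ) (L : ℕ), 1 ≤ ∑ k, m k →
      ∀ (S : RelayNetwork G m L), ∀ W ∈ S.sdrFeasible,
      ∀ (N : ℕ) (Ω : Type*) [MeasurableSpace Ω] (μ : Measure Ω) [IsProbabilityMeasure μ]
        (ξ : Fin N → Ω → VecIdx L → ℂ),
        (∀ n, IsCircularGaussian (ξ n) W μ) → iIndepFun ξ μ →
      ∀ w : Ω → VecIdx L → ℂ, (∀ ω, S.IsOutput W (fun n => ξ n ω) (w ω)) →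
        ENNReal.ofReal (1 - (5 / 6 : ℝ) ^ N) ≤
          μ {ω | S.rate W - S.rate (outer (w ω)) ≤
            Real.log ((∑ k, m k : ℕ) : ℝ) + Real.log (Real.log (3 * ((L : ℝ) + 1)) + 1 / 6)
              + Real.log 48}) := by
  refine ⟨?_, fun G m L S W hW N hN ξ => ⟨S.exists_isOutput hW hN ξ, fun hrank w hw => ?_⟩,
    fun G m L hM S W hW N Ω _ μ _ ξ hξ hind w hw => S.randomization_gap hM hW hξ hind hw⟩
  · obtain ⟨c, hc⟩ := exists_optimal_rankOne_matrixSolver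
    refine ⟨c + 1, fun G m L hL hM hML => ?_⟩
    obtain rfl : L = 2 := by omega
    obtain ⟨alg, hcost, halg⟩ := hc G m (by omega)
    refine ⟨alg, hcost.trans (Nat.mul_le_mul (Nat.le_succ c) ?_), halg⟩
    exact (show G + 1 ≤ G + ∑ k, m k + 2 by omega).trans (Nat.le_self_pow (Nat.succ_ne_zero c) _)
  · rw [← hw.eq_outer hrank]

theorem theorem1 :
    -- (a) a rank-one optimal solution of (SDR) is computable in polynomially many operations,
    -- and the randomization procedure run on any such solution loses nothing
    (∃ c : ℕ, ∀ (G : ℕ) (m : Fin G → ℕ) (L : ℕ), 2 ≤ L → 1 ≤ ∑ k, m k → (∑ k, m k) + L ≤ 3 →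
      ∃ alg : MatrixSolver G m L, alg.cost ≤ c * (G + (∑ k, m k) + L) ^ c ∧
        ∀ S : RelayNetwork G m L, S.IsSDROptimal (alg.run S) ∧ (alg.run S).rank ≤ 1) ∧
    (∀ (G : ℕ) (m : Fin G → ℕ) (L : ℕ), 2 ≤ L → 1 ≤ ∑ k, m k → (∑ k, m k) + L ≤ 3 →
      ∀ (S : RelayNetwork G m L) (W : Matrix (VecIdx L) (VecIdx L) ℂ),
        S.IsSDROptimal W → W.rank ≤ 1 →
        ∀ (N : ℕ), 1 ≤ N → ∀ ξ : Fin N → VecIdx L → ℂ,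
          (∃ w, S.IsOutput W ξ w) ∧
          ∀ w, S.IsOutput W ξ w → S.rate (outer w) = S.rate W) ∧
    -- (b) the gap for Gaussian randomization with `N` independent draws
    (∀ (G : ℕ) (m : Fin G → ℕ) (L : ℕ), 2 ≤ L → 1 ≤ ∑ k, m k → 3 < (∑ k, m k) + L →
      ∀ (S : RelayNetwork G m L) (W : Matrix (VecIdx L) (VecIdx L) ℂ), S.IsSDROptimal W →
      ∀ (N : ℕ), 1 ≤ N →
      ∀ (Ω : Type*) [MeasurableSpace Ω] (μ : Measure Ω) [IsProbabilityMeasure μ]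
        (ξ : Fin N → Ω → VecIdx L → ℂ),
        (∀ n, IsCircularGaussian (ξ n) W μ) → iIndepFun ξ μ →
      ∀ w : Ω → VecIdx L → ℂ, (∀ ω, S.IsOutput W (fun n => ξ n ω) (w ω)) →
        ENNReal.ofReal (1 - (5 / 6 : ℝ) ^ N) ≤
          μ {ω | S.rate W - S.rate (outer (w ω)) ≤
            Real.log ((∑ k, m k : ℕ) : ℝ) + Real.log (Real.log (3 * ((L : ℝ) + 1)) + 1 / 6)
              + Real.log 48}) := by
  obtain ⟨halg, hexact, hgap⟩ := theorem1_general
  exact ⟨halg, fun G m L _ _ _ S W hW hrank N hN ξ => (hexact G m L S W hW.1.1 N hN ξ).imp_right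
    (· hrank), fun G m L _ hM _ S W hW N _ => hgap G m L hM S W hW.1 N⟩
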